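/- For $n\ge 0$ let $\mathsf{SoS}_2$ be the set of real $n\times n$ matrices $X\succeq 0$ with $X_{ii}=1$ for all $i$. Let $\mathsf{SoS}_4$ be the set of real positive semidefinite matrices $\mathcal M$ with rows and columns indexed by the subsets of $[n]$ of size at most $2$ such that $\mathcal M[\emptyset,\emptyset]=1$ and $\mathcal M[S,T]=\mathcal M[S',T']$ whenever $S\Delta T=S'\Delta T'$. For $X\in\mathsf{SoS}_2$ put $$\alpha_{\mathrm{mag}}=\max_{i\ne j}|X_{ij}|,\qquad \alpha_{\mathrm{row}}=\max_i\Big(\sum_{j\ne i}X_{ij}^2\Big)^{1/2},\qquad \alpha_{\mathrm{spec}}=\|X\|$$ (spectral norm; a maximum over the empty set is $0$), and, for $C>0$, $\alpha=C\,\alpha_{\mathrm{mag}}(1+\alpha_{\mathrm{row}}^4)(1+\alpha_{\mathrm{spec}}^2)$. The map $\Phi$ is defined as follows. Write $X=MM^{\top}$ with $M\in\mathbb R^{n\times n}$. For $\kappa\ge n$ a power of $2$ let $M_\kappa=MH_\kappa^{\le n}$, where $H_\kappa^{\le n}$ consists of the first $n$ rows of the Sylvester–Hadamard matrix of order $\kappa$,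 normalized to be orthogonal. For $z\in\{\pm1\}^\kappa$ let $$q_{i,\kappa}(z)=\sum_{j\in[\kappa]}M_\kappa[i,j]z_j-2\sum_{\{j_1,j_2,j_3\}\subseteq[\kappa]}M_\kappa[i,j_1]M_\kappa[i,j_2]M_\kappa[i,j_3]\,z_{j_1}z_{j_2}z_{j_3},$$ where the second sum is over $3$-element subsets, and set $$\mathcal M^{(1)}[S,T]=\lim_{\kappa\to\infty}\mathbb E_{z\sim\{\pm1\}^\kappa}\Big[\prod_{i\in S\Delta T}q_{i,\kappa}(z)\Big],\qquad \Phi(X)=\frac{1}{1+\alpha}\,\mathcal M^{(1)}+\frac{\alpha}{1+\alpha}\,\mathrm{Id}.$$ **Theorem.** There is an absolute constant $C>0$ such that for every $n$ and every $X\in\mathsf{SoS}_2$: the limits defining $\mathcal M^{(1)}$ exist and do not depend on the choice of $M$; $\Phi(X)\in\mathsf{SoS}_4$; and for all $i\ne j$ $$\Phi(X)[\{i\},\{j\}]=\frac{X_{ij}+\tfrac23X_{ij}^3}{1+C\,\alpha_{\mathrm{mag}}(1+\alpha_{\mathrm{row}}^4)(1+\alpha_{\mathrm{spec}}^2)} .$$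 Moreover, there are polynomials $Q_k$ with rational coefficients in variables $y_{ab}$, $1\le a,b\le k$, independent of $n$ and $X$, such that for all $S,T$ and every enumeration $i_1,\dots,i_k$ of $S\Delta T$ without repetition $$\Phi(X)[S,T]=\frac{Q_k\big((X_{i_ai_b})_{a,b}\big)+\alpha\,\mathbf 1[S=T]}{1+\alpha}.$$ Thus, apart from the scalar $\alpha$, every entry $\Phi(X)[S,T]$ is a polynomial of constant degree in the $X_{ij}$ with $i,j\in S\cup T$. -/

import Mathlib

open scoped BigOperators symmDiff

noncomputable section

namespace SoSLift

/-- Feasible solutions of the degree-2 SoS (Goemans–Williamson) relaxation. -/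
def SoS2 (n : ℕ) : Set (Matrix (Fin n) (Fin n) ℝ) :=
  {X | X.PosSemidef ∧ ∀ i, X i i = 1}

/-- Subsets of `[n]` of size at most two, the index set of degree-4 pseudomoment matrices. -/
abbrev Idx (n : ℕ) : Type := {S : Finset (Fin n) // S.card ≤ 2}

/-- The singleton `{i}` as an index. -/
def single {n : ℕ} (i : Fin n) : Idx n := ⟨{i}, by simp⟩

/-- The empty set as an index. -/
def emptyIdx (n : ℕ) : Idx n := ⟨∅, by simp⟩

/-- Feasible solutions of the degree-4 SoS relaxation on Boolean variables. -/
def SoS4 (n : ℕ) : Set (Matrix (Idx n) (Idx n) ℝ) :=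
  {P | (∀ S T S' T' : Idx n, S.1 ∆ T.1 = S'.1 ∆ T'.1 → P S T = P S' T') ∧
    P (emptyIdx n) (emptyIdx n) = 1 ∧ P.PosSemidef}

/-- Largest magnitude of an off-diagonal entry (`0` if there is none). -/
def alphaMag {n : ℕ} (X : Matrix (Fin n) (Fin n) ℝ) : ℝ :=
  ⨆ p : {p : Fin n × Fin n // p.1 ≠ p.2}, |X p.1.1 p.1.2|

/-- Largest Euclidean norm of a row, the diagonal entry being left out. -/
def alphaRow {n : ℕ} (X : Matrix (Fin n) (Fin n) ℝ) : ℝ :=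
  ⨆ i : Fin n, √(∑ j ∈ Finset.univ.erase i, X i j ^ 2)

/-- Spectral norm: the operator norm for the Euclidean norm. -/
def alphaSpec {n : ℕ} (X : Matrix (Fin n) (Fin n) ℝ) : ℝ :=
  ‖Matrix.toEuclideanCLM (𝕜 := ℝ) X‖

def alpha (C : ℝ) {n : ℕ} (X : Matrix (Fin n) (Fin n) ℝ) : ℝ :=
  C * alphaMag X * (1 + alphaRow X ^ 4) * (1 + alphaSpec X ^ 2)

/-- Entry `(a, b)` of the normalized Sylvester–Hadamard matrix of order `2 ^ m`
(rows and columns are numbered from `0`): `(-1) ^ ⟨a, b⟩ / √(2 ^ m)`, where `⟨a, b⟩` is the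
inner product of the binary expansions of `a` and `b`. -/
def hadamard (m a b : ℕ) : ℝ :=
  (∏ t ∈ Finset.range m, if a.testBit t ∧ b.testBit t then (-1 : ℝ) else 1) / √(2 ^ m)

/-- The `n × 2 ^ m` matrix `M * H`, where `H` consists of the first `n` rows of the Hadamard
matrix of order `2 ^ m`. It is meant for `n ≤ 2 ^ m`; only large `m` matter below. -/
def spread {n : ℕ} (M : Matrix (Fin n) (Fin n) ℝ) (m : ℕ) : Matrix (Fin n) (Fin (2 ^ m)) ℝ :=
  M * Matrix.of fun (k : Fin n) (j : Fin (2 ^ m)) => hadamard m k.val j.val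

/-- Seed polynomial of the index `i`, evaluated at a sign vector `z`. -/
def seed {n κ : ℕ} (A : Matrix (Fin n) (Fin κ) ℝ) (i : Fin n) (z : Fin κ → ℤˣ) : ℝ :=
  ∑ j, A i j * ((z j : ℤ) : ℝ)
    - 2 * ∑ J ∈ Finset.powersetCard 3 Finset.univ, ∏ j ∈ J, A i j * ((z j : ℤ) : ℝ)

/-- Average over a uniformly random sign vector `z ∈ {±1} ^ (2 ^ m)` of the product of the seed
polynomials of the indices in `U`. -/
def seedMoment {n : ℕ} (M : Matrix (Fin n) (Fin n) ℝ) (U : Finset (Fin n)) (m : ℕ) : ℝ :=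
  𝔼 z : Fin (2 ^ m) → ℤˣ, ∏ i ∈ U, seed (spread M m) i z

open Classical in
/-- Some square matrix `M` with `M * Mᵀ = X`; there is one if `X` is positive semidefinite. -/
def factor {n : ℕ} (X : Matrix (Fin n) (Fin n) ℝ) : Matrix (Fin n) (Fin n) ℝ :=
  if h : ∃ M : Matrix (Fin n) (Fin n) ℝ, M * M.transpose = X then h.choose else 0

/-- The matrix of limiting seed moments. -/
def momentMatrix {n : ℕ} (X : Matrix (Fin n) (Fin n) ℝ) : Matrix (Idx n) (Idx n) ℝ :=
  Matrix.of fun S T => Filter.limUnder Filter.atTop (seedMoment (factor X) (S.1 ∆ T.1))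

/-- The lift `(1 - η) • momentMatrix X + η • 1` with `η = α / (1 + α)`. -/
def lift (C : ℝ) {n : ℕ} (X : Matrix (Fin n) (Fin n) ℝ) : Matrix (Idx n) (Idx n) ℝ :=
  (1 - alpha C X / (1 + alpha C X)) • momentMatrix X + (alpha C X / (1 + alpha C X)) • 1

end SoSLift

end

/-! Once `n ≤ 2 ^ m`, the rows of `A = spread M m` are unit vectors with entries of order `2 ^ (-m /
2)`, so `A z` behaves like a centred Gaussian vector `g` with covariance `M Mᵀ = X`. Newton's
identity turns the seed of `i` into `He₁(gᵢ) - He₃(gᵢ) / 3` plus a vanishing error (`seed_eq`).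
Polynomial moments converge by an approximate Stein identity (`tendsto_polyMean_stein`), so the
limits obey Wick's recursion (`tendsto_polyMean_wick`): they are polynomials in the entries of `X`,
whatever `M` is.

The limiting matrix is not a Gaussian Gram matrix: common indices drop out of `S ∆ T`, although `E
qᵢ²` tends to `5/3` and not to `1`. Its failure to be positive semidefinite has to be bounded by
`α`. Parity separates singletons from the empty set and pairs. On singletons the form is that of `X`
plus small off-diagonal cubes. On pairs, the moment of four distinct seeds is split by the Wick
degree of `qᵢ qⱼ` (`quartMoment_eq`). Degrees `0` and `2` form a Gram matrix even when indices
coincide (`sq_sum_le_quadSum_lowPart`), and degree `0` completes a square with the empty set.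
Degrees `4` and `6` have small norm on disjoint pairs (`OffDiagBound.disj_highPart`).

For overlapping pairs the low part must agree with the true entry up to a factor `α_mag`. The cubic
coefficient of the seed is tuned for exactly this: it cancels a term `X i j * X i l` that has no
such factor (`abs_pairMoment_sub_lowPart_le`). -/

namespace SoSLift

/-! ### Rows of the Sylvester–Hadamard matrix -/

lemma sum_hadamard_signs (m a b : ℕ) :
    ∑ j ∈ Finset.range (2 ^ m),
      (∏ t ∈ Finset.range m, if a.testBit t ∧ j.testBit t then (-1 : ℝ) else 1) *
        (∏ t ∈ Finset.range m, if b.testBit t ∧ j.testBit t then (-1 : ℝ) else 1) =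
      if ∀ t < m, a.testBit t = b.testBit t then (2 : ℝ) ^ m else 0 := by
  induction m with
  | zero => simp
  | succ m ih =>
    have hlow : ∀ (c j : ℕ), j < 2 ^ m →
        (∏ t ∈ Finset.range (m + 1), if c.testBit t ∧ j.testBit t then (-1 : ℝ) else 1) =
          ∏ t ∈ Finset.range m, if c.testBit t ∧ j.testBit t then (-1 : ℝ) else 1 := by
      intro c j hj
      rw [Finset.prod_range_succ, Nat.testBit_lt_two_pow hj]
      simp
    have hhigh : ∀ (c j : ℕ), j < 2 ^ m →
        (∏ t ∈ Finset.range (m + 1),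
          if c.testBit t ∧ (2 ^ m + j).testBit t then (-1 : ℝ) else 1) =
          (∏ t ∈ Finset.range m, if c.testBit t ∧ j.testBit t then (-1 : ℝ) else 1) *
            if c.testBit m then (-1 : ℝ) else 1 := by
      intro c j hj
      rw [Finset.prod_range_succ]
      congr 1
      · refine Finset.prod_congr rfl fun t ht => ?_
        rw [Nat.testBit_two_pow_add_gt (Finset.mem_range.1 ht)]
      · rw [Nat.testBit_two_pow_add_eq, Nat.testBit_lt_two_pow hj]
        simp
    -- Split by the top bit of `j`. The upper half repeats the lower one, times the signs of `a` and
    -- `b` at bit `m`, so the sum is multiplied by `2` or by `0`.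
    rw [pow_succ, mul_two, Finset.sum_range_add]
    rw [Finset.sum_congr rfl fun j hj => by
      rw [hlow a j (Finset.mem_range.1 hj), hlow b j (Finset.mem_range.1 hj)]]
    rw [Finset.sum_congr (s₁ := Finset.range (2 ^ m))
      (f := fun x => (∏ t ∈ Finset.range (m + 1),
        if a.testBit t ∧ (2 ^ m + x).testBit t then (-1 : ℝ) else 1) * _) rfl fun j hj => by
      rw [hhigh a j (Finset.mem_range.1 hj), hhigh b j (Finset.mem_range.1 hj), mul_mul_mul_comm]]
    rw [← Finset.sum_mul, ih]
    have hsplit : (∀ t < m + 1, a.testBit t = b.testBit t) ↔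
        (∀ t < m, a.testBit t = b.testBit t) ∧ a.testBit m = b.testBit m := by
      constructor
      · exact fun h => ⟨fun t ht => h t (by omega), h m (by omega)⟩
      · rintro ⟨h, h'⟩ t ht
        rcases Nat.lt_succ_iff_lt_or_eq.1 ht with h1 | rfl
        · exact h t h1
        · exact h'
    simp only [hsplit]
    by_cases h : ∀ t < m, a.testBit t = b.testBit t
    · simp only [if_pos h, and_iff_right h]
      cases a.testBit m <;> cases b.testBit m <;> simp [pow_succ] <;> ring
    · simp [h]

lemma hadamard_orthonormal {m a b : ℕ} (ha : a < 2 ^ m) (hb : b < 2 ^ m) :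
    ∑ j : Fin (2 ^ m), hadamard m a j * hadamard m b j = if a = b then 1 else 0 := by
  rw [Fin.sum_univ_eq_sum_range (fun j => hadamard m a j * hadamard m b j)]
  have h2 : (0 : ℝ) < 2 ^ m := by positivity
  have hs : √((2 : ℝ) ^ m) * √(2 ^ m) = 2 ^ m := Real.mul_self_sqrt h2.le
  have : ∀ j, hadamard m a j * hadamard m b j =
      ((∏ t ∈ Finset.range m, if a.testBit t ∧ j.testBit t then (-1 : ℝ) else 1) *
        (∏ t ∈ Finset.range m, if b.testBit t ∧ j.testBit t then (-1 : ℝ) else 1)) / 2 ^ m := by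
    intro j
    rw [hadamard, hadamard, div_mul_div_comm, hs]
  simp only [this]
  rw [← Finset.sum_div, sum_hadamard_signs]
  have : (∀ t < m, a.testBit t = b.testBit t) ↔ a = b := by
    refine ⟨fun h => Nat.eq_of_testBit_eq fun t => ?_, fun h t _ => by rw [h]⟩
    by_cases ht : t < m
    · exact h t ht
    · have : 2 ^ m ≤ 2 ^ t := Nat.pow_le_pow_right (by norm_num) (by omega)
      rw [Nat.testBit_lt_two_pow (ha.trans_le this), Nat.testBit_lt_two_pow (hb.trans_le this)]
  simp only [this]
  split_ifs
  · exact div_self h2.ne'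
  · simp

lemma abs_hadamard (m a b : ℕ) : |hadamard m a b| = 1 / √(2 ^ m) := by
  rw [hadamard, abs_div, Finset.abs_prod, abs_of_nonneg (Real.sqrt_nonneg _)]
  congr 1
  refine Finset.prod_eq_one fun t _ => ?_
  split_ifs <;> simp

lemma spread_mul_transpose {n m : ℕ} (M : Matrix (Fin n) (Fin n) ℝ) (h : n ≤ 2 ^ m) :
    spread M m * (spread M m).transpose = M * M.transpose := by
  set H : Matrix (Fin n) (Fin (2 ^ m)) ℝ :=
    Matrix.of fun (k : Fin n) (j : Fin (2 ^ m)) => hadamard m k.val j.val with hH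
  have hHH : H * H.transpose = 1 := by
    ext a b
    rw [Matrix.mul_apply, Matrix.one_apply]
    simp only [hH, Matrix.of_apply, Matrix.transpose_apply]
    rw [hadamard_orthonormal (a.2.trans_le h) (b.2.trans_le h)]
    simp [Fin.ext_iff]
  change M * H * (M * H).transpose = _
  rw [Matrix.transpose_mul, Matrix.mul_assoc, ← Matrix.mul_assoc H, hHH, Matrix.one_mul]

/-- All Hadamard entries have the same modulus, so one constant serves every `m`. No coordinate of
`z` dominates, which is what makes the Gaussian limit possible. -/
lemma abs_spread_le {n : ℕ} (M : Matrix (Fin n) (Fin n) ℝ) :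
    ∃ c : ℝ, 0 ≤ c ∧ ∀ m i j, |spread M m i j| ≤ c / √(2 ^ m) := by
  refine ⟨∑ i, ∑ k, |M i k|, by positivity, fun m i j => ?_⟩
  rw [spread, Matrix.mul_apply]
  refine (Finset.abs_sum_le_sum_abs _ _).trans ?_
  simp only [abs_mul, Matrix.of_apply, abs_hadamard]
  rw [← Finset.sum_mul, mul_one_div]
  refine div_le_div_of_nonneg_right ?_ (Real.sqrt_nonneg _)
  exact Finset.single_le_sum (f := fun i => ∑ k, |M i k|) (fun _ _ => by positivity)
    (Finset.mem_univ i)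

/-! ### Elementary symmetric sums -/

lemma sum_powersetCard_succ_insert {ι : Type*} [DecidableEq ι] (a : ι → ℝ) {s : Finset ι} {x : ι}
    (hx : x ∉ s) (k : ℕ) :
    ∑ J ∈ (insert x s).powersetCard (k + 1), ∏ j ∈ J, a j =
      ∑ J ∈ s.powersetCard (k + 1), ∏ j ∈ J, a j +
        a x * ∑ J ∈ s.powersetCard k, ∏ j ∈ J, a j := by
  rw [Finset.powersetCard_succ_insert hx, Finset.sum_union, Finset.sum_image, Finset.mul_sum]
  · congr 1
    refine Finset.sum_congr rfl fun J hJ => ?_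
    rw [Finset.prod_insert fun h => hx ((Finset.mem_powersetCard.1 hJ).1 h)]
  · intro J hJ K hK h
    have hJ' : x ∉ J := fun h => hx ((Finset.mem_powersetCard.1 hJ).1 h)
    have hK' : x ∉ K := fun h => hx ((Finset.mem_powersetCard.1 hK).1 h)
    rw [← Finset.erase_insert hJ', ← Finset.erase_insert hK']
    exact congrArg (fun S => S.erase x) h
  · rw [Finset.disjoint_left]
    intro J hJ hJ'
    obtain ⟨K, -, rfl⟩ := Finset.mem_image.1 hJ'
    exact hx ((Finset.mem_powersetCard.1 hJ).1 (Finset.mem_insert_self _ _))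

lemma two_mul_esymm_two {ι : Type*} (a : ι → ℝ) (s : Finset ι) :
    2 * ∑ J ∈ s.powersetCard 2, ∏ j ∈ J, a j = (∑ j ∈ s, a j) ^ 2 - ∑ j ∈ s, a j ^ 2 := by
  classical
  induction s using Finset.induction_on with
  | empty => simp [Finset.powersetCard_eq_empty.2 (show (∅ : Finset ι).card < 2 by simp)]
  | insert x s hx ih =>
    rw [sum_powersetCard_succ_insert a hx, Finset.sum_insert hx, Finset.sum_insert hx, mul_add, ih,
      Finset.powersetCard_one]
    simp only [Finset.sum_map, Function.Embedding.coeFn_mk, Finset.prod_singleton]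
    ring

/-- Newton's identity. When the squares sum to `1`, it leaves a cubic polynomial in the linear form
and a sum of cubes, the latter negligible for small entries. -/
lemma six_mul_esymm_three {ι : Type*} (a : ι → ℝ) (s : Finset ι) :
    6 * ∑ J ∈ s.powersetCard 3, ∏ j ∈ J, a j =
      (∑ j ∈ s, a j) ^ 3 - 3 * (∑ j ∈ s, a j) * (∑ j ∈ s, a j ^ 2) + 2 * ∑ j ∈ s, a j ^ 3 := by
  classical
  induction s using Finset.induction_on with
  | empty => simp [Finset.powersetCard_eq_empty.2 (show (∅ : Finset ι).card < 3 by simp)]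
  | insert x s hx ih =>
    have h2 := two_mul_esymm_two a s
    rw [sum_powersetCard_succ_insert a hx, Finset.sum_insert hx, Finset.sum_insert hx,
      Finset.sum_insert hx, mul_add, ih]
    linear_combination 3 * a x * h2

/-! ### Rademacher sums -/

/-- The vector of Rademacher sums `A z`. -/
noncomputable def radSum {n κ : ℕ} (A : Matrix (Fin n) (Fin κ) ℝ) (z : Fin κ → ℤˣ) : Fin n → ℝ :=
  fun i => ∑ j, A i j * ((z j : ℤ) : ℝ)

lemma unit_cast_sq (u : ℤˣ) : ((u : ℤ) : ℝ) ^ 2 = 1 := by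
  rcases Int.units_eq_one_or u with rfl | rfl <;> simp

lemma abs_unit_cast (u : ℤˣ) : |((u : ℤ) : ℝ)| = 1 := by
  rcases Int.units_eq_one_or u with rfl | rfl <;> simp

/-- Independence gives a product of `cosh (a j)`, each at most `exp (a j ^ 2 / 2)`: a sub-Gaussian
bound that does not see `κ`. -/
lemma expect_exp_le {κ : ℕ} (a : Fin κ → ℝ) :
    𝔼 z : Fin κ → ℤˣ, Real.exp (∑ j, a j * ((z j : ℤ) : ℝ)) ≤ Real.exp ((∑ j, a j ^ 2) / 2) := by
  have h : ∑ z : Fin κ → ℤˣ, Real.exp (∑ j, a j * ((z j : ℤ) : ℝ)) =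
      ∏ j, (2 * Real.cosh (a j)) := by
    simp only [Real.exp_sum]
    rw [← Fintype.prod_sum (fun j (u : ℤˣ) => Real.exp (a j * ((u : ℤ) : ℝ)))]
    refine Finset.prod_congr rfl fun j _ => ?_
    rw [Real.cosh_eq]
    simp [UnitsInt.univ]
    ring
  rw [Finset.expect_eq_sum_div_card, h, Finset.prod_mul_distrib, Finset.sum_div, Real.exp_sum]
  simp only [Finset.prod_const, Finset.card_univ, Fintype.card_fin, Fintype.card_pi,
    Fintype.card_units_int]
  push_cast
  rw [mul_div_cancel_left₀ _ (by positivity)]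
  exact Finset.prod_le_prod (fun j _ => (Real.cosh_pos _).le) fun j _ => Real.cosh_le_exp_half_sq _

/-- The only integrability input. The weight is dominated by exponentials of `± x i`, so the bound
is uniform in `κ` and `A`. -/
lemma expect_weight_le (n N : ℕ) :
    ∃ B : ℝ, 0 ≤ B ∧ ∀ (κ : ℕ) (A : Matrix (Fin n) (Fin κ) ℝ), (∀ i, ∑ j, A i j ^ 2 ≤ 1) →
      𝔼 z : Fin κ → ℤˣ, (1 + ‖radSum A z‖) ^ N ≤ B := by
  refine ⟨N.factorial * Real.exp 1 * (1 + ∑ _i : Fin n, (Real.exp (1 / 2) + Real.exp (1 / 2))),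
    by positivity, fun κ A hA => ?_⟩
  have hpt : ∀ x : Fin n → ℝ, (1 + ‖x‖) ^ N ≤
      N.factorial * Real.exp 1 * (1 + ∑ i, (Real.exp (x i) + Real.exp (-x i))) := by
    intro x
    set B := 1 + ∑ i, (Real.exp (x i) + Real.exp (-x i)) with hB
    have hB1 : 1 ≤ B := le_add_of_nonneg_right (by positivity)
    have h1 : ‖x‖ ≤ Real.log B := by
      rw [pi_norm_le_iff_of_nonneg (Real.log_nonneg hB1)]
      intro i
      rw [Real.le_log_iff_exp_le (by positivity), Real.norm_eq_abs]
      have h2 : Real.exp |x i| ≤ Real.exp (x i) + Real.exp (-x i) := by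
        rcases abs_cases (x i) with ⟨h, -⟩ | ⟨h, -⟩ <;> rw [h] <;>
          linarith [Real.exp_pos (x i), Real.exp_pos (-x i)]
      have h3 := Finset.single_le_sum (f := fun i => Real.exp (x i) + Real.exp (-x i))
        (fun _ _ => by positivity) (Finset.mem_univ i)
      linarith
    have h2 : Real.exp ‖x‖ ≤ B := by
      rwa [Real.le_log_iff_exp_le (by positivity)] at h1
    have h3 := Real.pow_div_factorial_le_exp (1 + ‖x‖) (by positivity) N
    rw [div_le_iff₀ (by positivity), Real.exp_add] at h3
    calc _ ≤ _ := h3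
      _ ≤ Real.exp 1 * B * N.factorial := by gcongr
      _ = _ := by ring
  have hexp : ∀ i, 𝔼 z : Fin κ → ℤˣ, Real.exp (radSum A z i) ≤ Real.exp (1 / 2) := fun i =>
    (expect_exp_le (A i)).trans (Real.exp_le_exp.2 (by linarith [hA i]))
  have hexp' : ∀ i, 𝔼 z : Fin κ → ℤˣ, Real.exp (-radSum A z i) ≤ Real.exp (1 / 2) := fun i => by
    have := expect_exp_le (fun j => -A i j)
    simp only [neg_mul, Finset.sum_neg_distrib, neg_sq] at this
    exact this.trans (Real.exp_le_exp.2 (by linarith [hA i]))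
  refine (Finset.expect_le_expect fun z _ => hpt (radSum A z)).trans ?_
  rw [← Finset.mul_expect, Finset.expect_add_distrib, Finset.expect_const Finset.univ_nonempty,
    Finset.expect_sum_comm]
  gcongr with i
  rw [Finset.expect_add_distrib]
  exact add_le_add (hexp i) (hexp' i)

/-! ### Stein's identity for Rademacher sums, asymptotically -/

/-- The constant vector field `h` as a derivation on polynomials. -/
noncomputable def dirDeriv {n : ℕ} (h : Fin n → ℝ) :
    Derivation ℝ (MvPolynomial (Fin n) ℝ) (MvPolynomial (Fin n) ℝ) :=
  MvPolynomial.mkDerivation ℝ fun s => MvPolynomial.C (h s)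

lemma dirDeriv_X {n : ℕ} (h : Fin n → ℝ) (s : Fin n) :
    dirDeriv h (MvPolynomial.X s) = MvPolynomial.C (h s) :=
  MvPolynomial.mkDerivation_X _ _ _

lemma sum_smul_dirDeriv {n : ℕ} {ι : Type*} (s : Finset ι) (a : ι → ℝ) (h : ι → Fin n → ℝ)
    (P : MvPolynomial (Fin n) ℝ) :
    ∑ j ∈ s, a j • dirDeriv (h j) P = dirDeriv (∑ j ∈ s, a j • h j) P := by
  have happ : ∀ Q, (∑ j ∈ s, a j • dirDeriv (h j)) Q = ∑ j ∈ s, a j • dirDeriv (h j) Q := by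
    intro Q
    have := congrFun (map_sum (Derivation.coeFnAddMonoidHom (R := ℝ)
      (A := MvPolynomial (Fin n) ℝ) (M := MvPolynomial (Fin n) ℝ))
      (fun j => a j • dirDeriv (h j)) s) Q
    rw [Finset.sum_apply] at this
    exact this
  have : ∑ j ∈ s, a j • dirDeriv (h j) = dirDeriv (∑ j ∈ s, a j • h j) := by
    refine MvPolynomial.derivation_ext fun r => ?_
    rw [happ]
    simp [dirDeriv_X, MvPolynomial.smul_eq_C_mul]
  rw [← this, happ]

/-- First order Taylor expansion of a polynomial, with polynomial growth of the constants. -/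
lemma taylor_bound {n : ℕ} (P : MvPolynomial (Fin n) ℝ) :
    ∃ (K : ℝ) (N : ℕ), 0 ≤ K ∧ ∀ x h : Fin n → ℝ, ‖h‖ ≤ 1 →
      |MvPolynomial.eval (x - h) P| ≤ K * (1 + ‖x‖) ^ N ∧
      |MvPolynomial.eval (x - h) P - MvPolynomial.eval x P| ≤ K * (1 + ‖x‖) ^ N * ‖h‖ ∧
      |MvPolynomial.eval x P - MvPolynomial.eval (x - h) P - MvPolynomial.eval x (dirDeriv h P)| ≤
        K * (1 + ‖x‖) ^ N * ‖h‖ ^ 2 := by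
  -- The three bounds are carried together: after multiplication by a variable, each error estimate
  -- also needs the preceding, weaker bound for `P`.
  induction P using MvPolynomial.induction_on with
  | C a => exact ⟨|a|, 0, abs_nonneg a, fun x h _ => by
      simp only [MvPolynomial.eval_C, pow_zero, mul_one, sub_self, abs_zero,
        MvPolynomial.derivation_C, map_zero]
      refine ⟨le_rfl, ?_, ?_⟩ <;> positivity⟩
  | add P Q hP hQ =>
    obtain ⟨K, N, hK, h1⟩ := hP
    obtain ⟨L, R, hL, h2⟩ := hQ
    refine ⟨K + L, N + R, by positivity, fun x h hh => ?_⟩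
    obtain ⟨a1, a2, a3⟩ := h1 x h hh
    obtain ⟨b1, b2, b3⟩ := h2 x h hh
    have hx : 1 ≤ 1 + ‖x‖ := le_add_of_nonneg_right (norm_nonneg x)
    have hN : K * (1 + ‖x‖) ^ N ≤ K * (1 + ‖x‖) ^ (N + R) := by gcongr; omega
    have hR : L * (1 + ‖x‖) ^ R ≤ L * (1 + ‖x‖) ^ (N + R) := by gcongr; omega
    simp only [map_add, add_mul]
    refine ⟨?_, ?_, ?_⟩
    · exact (abs_add_le _ _).trans (add_le_add (a1.trans hN) (b1.trans hR))
    · rw [add_sub_add_comm]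
      refine (abs_add_le _ _).trans (add_le_add (a2.trans ?_) (b2.trans ?_)) <;> gcongr
    · rw [add_sub_add_comm, add_sub_add_comm]
      refine (abs_add_le _ _).trans (add_le_add (a3.trans ?_) (b3.trans ?_)) <;> gcongr
  | mul_X P s hP =>
    obtain ⟨K, N, hK, h1⟩ := hP
    refine ⟨2 * K, N + 1, by positivity, fun x h hh => ?_⟩
    obtain ⟨a1, a2, a3⟩ := h1 x h hh
    have hxs : |x s| ≤ 1 + ‖x‖ := by
      have := norm_le_pi_norm x s; rw [Real.norm_eq_abs] at this; linarith
    have hhs : |h s| ≤ ‖h‖ := norm_le_pi_norm h s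
    have hxh : |x s - h s| ≤ 1 + ‖x‖ := by
      have := norm_le_pi_norm x s; rw [Real.norm_eq_abs] at this
      exact (abs_sub _ _).trans (by linarith)
    have hw : 1 ≤ 1 + ‖x‖ := le_add_of_nonneg_right (norm_nonneg x)
    set W := K * (1 + ‖x‖) ^ N with hW
    have hW0 : 0 ≤ W := by positivity
    have hW2 : 2 * K * (1 + ‖x‖) ^ (N + 1) = 2 * W * (1 + ‖x‖) := by rw [hW]; ring
    have hWle : W ≤ W * (1 + ‖x‖) := le_mul_of_one_le_right hW0 hw
    rw [hW2]
    simp only [map_mul, MvPolynomial.eval_X, Derivation.leibniz, dirDeriv_X, smul_eq_mul, map_add,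
      MvPolynomial.eval_C, Pi.sub_apply]
    refine ⟨?_, ?_, ?_⟩
    · rw [abs_mul]
      have := mul_le_mul a1 hxh (abs_nonneg _) hW0
      nlinarith [norm_nonneg x]
    · have e : MvPolynomial.eval (x - h) P * (x s - h s) - MvPolynomial.eval x P * x s =
          (MvPolynomial.eval (x - h) P - MvPolynomial.eval x P) * x s
            - MvPolynomial.eval (x - h) P * h s := by ring
      rw [e]
      refine (abs_sub _ _).trans ?_
      rw [abs_mul, abs_mul]
      have t1 := mul_le_mul a2 hxs (abs_nonneg _) (by positivity)
      have t2 := mul_le_mul a1 hhs (abs_nonneg _) hW0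
      have t3 := mul_le_mul_of_nonneg_right hWle (norm_nonneg h)
      linarith
    · have e : MvPolynomial.eval x P * x s - MvPolynomial.eval (x - h) P * (x s - h s) -
          (MvPolynomial.eval x P * h s + x s * MvPolynomial.eval x (dirDeriv h P)) =
          (MvPolynomial.eval x P - MvPolynomial.eval (x - h) P
            - MvPolynomial.eval x (dirDeriv h P)) * x s
            + (MvPolynomial.eval (x - h) P - MvPolynomial.eval x P) * h s := by ring
      rw [e]
      refine (abs_add_le _ _).trans ?_
      rw [abs_mul, abs_mul]
      have t1 := mul_le_mul a3 hxs (abs_nonneg _) (by positivity)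
      have t2 := mul_le_mul a2 hhs (abs_nonneg _) (by positivity)
      have t3 := mul_le_mul_of_nonneg_right hWle (sq_nonneg ‖h‖)
      nlinarith

lemma radSum_mul_mulSingle {n κ : ℕ} (A : Matrix (Fin n) (Fin κ) ℝ) (z : Fin κ → ℤˣ)
    (j : Fin κ) :
    radSum A (z * Pi.mulSingle j (-1)) =
      radSum A z - fun i => 2 * ((z j : ℤ) : ℝ) * A i j := by
  funext i
  simp only [radSum, Pi.sub_apply]
  rw [eq_sub_iff_add_eq, ← Finset.sum_erase_add _ _ (Finset.mem_univ j),
    ← Finset.sum_erase_add (a := j) _ _ (Finset.mem_univ j), add_assoc]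
  congr 1
  · refine Finset.sum_congr rfl fun k hk => ?_
    simp [Pi.mulSingle_eq_of_ne (Finset.ne_of_mem_erase hk)]
  · simp
    ring

/-- Flipping the sign of `z j` preserves the uniform measure; averaging both expressions produces a
discrete derivative in direction `j`. -/
lemma expect_coord_mul {κ : ℕ} (j : Fin κ) (F : (Fin κ → ℤˣ) → ℝ) :
    𝔼 z, ((z j : ℤ) : ℝ) * F z =
      𝔼 z, ((z j : ℤ) : ℝ) / 2 * (F z - F (z * Pi.mulSingle j (-1))) := by
  have h : 𝔼 z : Fin κ → ℤˣ, ((z j : ℤ) : ℝ) * F z =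
      𝔼 z : Fin κ → ℤˣ, -((z j : ℤ) : ℝ) * F (z * Pi.mulSingle j (-1)) := by
    symm
    refine Fintype.expect_equiv (Equiv.mulRight (Pi.mulSingle j (-1))) _ _ fun z => ?_
    simp
  have h2 : 𝔼 z, ((z j : ℤ) : ℝ) / 2 * (F z - F (z * Pi.mulSingle j (-1))) =
      (𝔼 z, ((z j : ℤ) : ℝ) * F z +
        𝔼 z : Fin κ → ℤˣ, -((z j : ℤ) : ℝ) * F (z * Pi.mulSingle j (-1))) / 2 := by
    rw [← Finset.expect_add_distrib, Finset.expect_div]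
    refine Finset.expect_congr rfl fun z _ => by ring
  rw [h2, ← h]
  ring

lemma abs_expect_le {ι : Type*} [Fintype ι] {f g : ι → ℝ} (h : ∀ i, |f i| ≤ g i) :
    |𝔼 i, f i| ≤ 𝔼 i, g i := by
  rw [abs_le, ← Finset.expect_neg_distrib]
  exact ⟨Finset.expect_le_expect fun i _ => neg_le_of_abs_le (h i),
    Finset.expect_le_expect fun i _ => le_of_abs_le (h i)⟩

/-- The flip moves `radSum A z` by `2 z_j` times column `j`, a vector of norm at most `2 * ε`.
Taylor expansion replaces the half-difference by a derivative along that column, the two factors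
`z_j` cancelling, with error of order `ε ^ 2`. -/
lemma abs_expect_coord_mul_sub_le {n : ℕ} (P : MvPolynomial (Fin n) ℝ) :
    ∃ L : ℝ, 0 ≤ L ∧ ∀ (κ : ℕ) (A : Matrix (Fin n) (Fin κ) ℝ) (ε : ℝ),
      (∀ i, ∑ j, A i j ^ 2 ≤ 1) → (∀ i j, |A i j| ≤ ε) → 0 ≤ ε → 2 * ε ≤ 1 → ∀ j,
      |𝔼 z : Fin κ → ℤˣ, ((z j : ℤ) : ℝ) * MvPolynomial.eval (radSum A z) P -
        𝔼 z : Fin κ → ℤˣ, MvPolynomial.eval (radSum A z) (dirDeriv (fun i => A i j) P)| ≤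
        L * ε ^ 2 := by
  obtain ⟨K, N, hK, hP⟩ := taylor_bound P
  obtain ⟨B, hB, hw⟩ := expect_weight_le n N
  refine ⟨2 * K * B, by positivity, fun κ A ε hA hε hε0 hε1 j => ?_⟩
  rw [expect_coord_mul, ← Finset.expect_sub_distrib]
  have hpt : ∀ z : Fin κ → ℤˣ,
      |((z j : ℤ) : ℝ) / 2 * (MvPolynomial.eval (radSum A z) P -
          MvPolynomial.eval (radSum A (z * Pi.mulSingle j (-1))) P) -
        MvPolynomial.eval (radSum A z) (dirDeriv (fun i => A i j) P)| ≤
        2 * K * ε ^ 2 * (1 + ‖radSum A z‖) ^ N := by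
    intro z
    set h : Fin n → ℝ := fun i => 2 * ((z j : ℤ) : ℝ) * A i j with hh
    have hnorm : ‖h‖ ≤ 2 * ε := by
      rw [pi_norm_le_iff_of_nonneg (by positivity)]
      intro i
      rw [Real.norm_eq_abs, hh, abs_mul, abs_mul, abs_unit_cast]
      simpa using hε i j
    have hD : MvPolynomial.eval (radSum A z) (dirDeriv (fun i => A i j) P) =
        ((z j : ℤ) : ℝ) / 2 * MvPolynomial.eval (radSum A z) (dirDeriv h P) := by
      have := sum_smul_dirDeriv {()} (fun _ => 2 * ((z j : ℤ) : ℝ)) (fun _ i => A i j) P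
      simp only [Finset.sum_singleton] at this
      have e : (2 * ((z j : ℤ) : ℝ)) • (fun i => A i j) = h := by
        funext i; simp [hh]
      rw [e] at this
      rw [← this, MvPolynomial.smul_eval]
      linear_combination -MvPolynomial.eval (radSum A z) (dirDeriv (fun i => A i j) P) *
        unit_cast_sq (z j)
    rw [radSum_mul_mulSingle, hD, ← mul_sub, abs_mul, abs_div, abs_unit_cast]
    have h3 := (hP (radSum A z) h (hnorm.trans hε1)).2.2
    have h4 : ‖h‖ ^ 2 ≤ (2 * ε) ^ 2 := by gcongr
    have h5 := mul_le_mul_of_nonneg_left h4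
      (show 0 ≤ K * (1 + ‖radSum A z‖) ^ N by positivity)
    rw [abs_two]
    nlinarith
  refine (abs_expect_le hpt).trans ?_
  rw [← Finset.mul_expect]
  have := mul_le_mul_of_nonneg_left (hw κ A hA) (show 0 ≤ 2 * K * ε ^ 2 by positivity)
  linarith

/-- Summed with weights `A i j`, the derivatives along columns combine into one along row `i` of `A
Aᵀ`. There are `κ` errors of size `ε * ε ^ 2`; for `ε = c / √κ` the total is of order `1 / √κ`. -/
lemma abs_expect_radSum_mul_sub_le {n : ℕ} (P : MvPolynomial (Fin n) ℝ) :
    ∃ L : ℝ, 0 ≤ L ∧ ∀ (κ : ℕ) (A : Matrix (Fin n) (Fin κ) ℝ) (ε : ℝ),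
      (∀ i, ∑ j, A i j ^ 2 ≤ 1) → (∀ i j, |A i j| ≤ ε) → 0 ≤ ε → 2 * ε ≤ 1 → ∀ i,
      |𝔼 z : Fin κ → ℤˣ, MvPolynomial.eval (radSum A z) (MvPolynomial.X i * P) -
        𝔼 z : Fin κ → ℤˣ, MvPolynomial.eval (radSum A z)
          (dirDeriv ((A * A.transpose) i) P)| ≤ L * (κ * ε ^ 3) := by
  obtain ⟨L, hL, h⟩ := abs_expect_coord_mul_sub_le P
  refine ⟨L, hL, fun κ A ε hA hε hε0 hε1 i => ?_⟩
  have e1 : 𝔼 z : Fin κ → ℤˣ, MvPolynomial.eval (radSum A z) (MvPolynomial.X i * P) =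
      ∑ j, A i j * 𝔼 z : Fin κ → ℤˣ, ((z j : ℤ) : ℝ) * MvPolynomial.eval (radSum A z) P := by
    simp only [Finset.mul_expect]
    rw [← Finset.expect_sum_comm]
    refine Finset.expect_congr rfl fun z _ => ?_
    rw [map_mul, MvPolynomial.eval_X]
    simp only [radSum, Finset.sum_mul, mul_assoc]
  have e2 : 𝔼 z : Fin κ → ℤˣ, MvPolynomial.eval (radSum A z) (dirDeriv ((A * A.transpose) i) P) =
      ∑ j, A i j * 𝔼 z : Fin κ → ℤˣ,
        MvPolynomial.eval (radSum A z) (dirDeriv (fun s => A s j) P) := by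
    simp only [Finset.mul_expect]
    rw [← Finset.expect_sum_comm]
    refine Finset.expect_congr rfl fun z _ => ?_
    have e3 : (A * A.transpose) i = ∑ j, A i j • fun s => A s j := by
      funext s
      simp [Matrix.mul_apply]
    rw [e3, ← sum_smul_dirDeriv, map_sum]
    simp [MvPolynomial.smul_eval]
  rw [e1, e2, ← Finset.sum_sub_distrib]
  simp only [← mul_sub]
  refine (Finset.abs_sum_le_sum_abs _ _).trans ?_
  calc _ ≤ ∑ _j : Fin κ, ε * (L * ε ^ 2) := Finset.sum_le_sum fun j _ => by
        rw [abs_mul]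
        exact mul_le_mul (hε i j) (h κ A ε hA hε hε0 hε1 j) (abs_nonneg _) hε0
    _ = _ := by simp; ring

/-- Average of a polynomial in the Rademacher sums given by `spread M m`. -/
noncomputable def polyMean {n : ℕ} (M : Matrix (Fin n) (Fin n) ℝ) (m : ℕ) :
    MvPolynomial (Fin n) ℝ →ₗ[ℝ] ℝ where
  toFun P := 𝔼 z, MvPolynomial.eval (radSum (spread M m) z) P
  map_add' P Q := by simp [Finset.expect_add_distrib]
  map_smul' a P := by simp [MvPolynomial.smul_eval, Finset.mul_expect]

lemma tendsto_div_sqrt_two_pow (c : ℝ) :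
    Filter.Tendsto (fun m : ℕ => c / √(2 ^ m)) Filter.atTop (nhds 0) :=
  Filter.Tendsto.const_div_atTop
    (Real.tendsto_sqrt_atTop.comp (tendsto_pow_atTop_atTop_of_one_lt one_lt_two)) c

lemma tendsto_polyMean_stein {n : ℕ} {M X : Matrix (Fin n) (Fin n) ℝ} (hM : M * M.transpose = X)
    (hX : ∀ i, X i i = 1) (i : Fin n) (P : MvPolynomial (Fin n) ℝ) :
    Filter.Tendsto (fun m => polyMean M m (MvPolynomial.X i * P) - polyMean M m (dirDeriv (X i) P))
      Filter.atTop (nhds 0) := by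
  obtain ⟨L, hL, h⟩ := abs_expect_radSum_mul_sub_le P
  obtain ⟨c, hc, hA⟩ := abs_spread_le M
  have hlim : Filter.Tendsto (fun m : ℕ => L * (c ^ 3 / √(2 ^ m))) Filter.atTop (nhds 0) := by
    simpa using (tendsto_div_sqrt_two_pow (c ^ 3)).const_mul L
  refine squeeze_zero_norm' ?_ hlim
  have hsmall : ∀ᶠ m : ℕ in Filter.atTop, c / √(2 ^ m) < 1 / 2 :=
    (tendsto_div_sqrt_two_pow c).eventually_lt_const (by norm_num)
  have hbig : ∀ᶠ m : ℕ in Filter.atTop, n ≤ 2 ^ m :=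
    (tendsto_pow_atTop_atTop_of_one_lt (one_lt_two (α := ℕ))).eventually_ge_atTop n
  filter_upwards [hsmall, hbig] with m h1 h2
  have hAA := spread_mul_transpose M h2
  rw [hM] at hAA
  have h3 := h (2 ^ m) (spread M m) (c / √(2 ^ m)) (fun i => ?_) (hA m) (by positivity)
    (by linarith) i
  · rw [hAA] at h3
    refine (Real.norm_eq_abs _).trans_le (h3.trans_eq ?_)
    have hs : √((2 : ℝ) ^ m) ^ 2 = 2 ^ m := Real.sq_sqrt (by positivity)
    have hp : 0 < √((2 : ℝ) ^ m) := by positivity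
    push_cast
    field_simp
    rw [hs]
    ring
  · have := congrFun (congrFun hAA i) i
    rw [hX, Matrix.mul_apply] at this
    simp only [Matrix.transpose_apply] at this
    rw [← this]
    exact (Finset.sum_congr rfl fun j _ => sq _).le

/-! ### Hermite polynomials and their limiting moments -/

/-- The Hermite polynomials of probability theory, evaluated at `x`. -/
def he {R : Type*} [CommRing R] (x : R) : ℕ → R
  | 0 => 1
  | 1 => x
  | (a + 2) => x * he x (a + 1) - (a + 1) * he x a

/-- At `a = 0` the truncated index `a - 1` carries coefficient `0`. The same convention makes `wick`
correct at empty slots. -/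
lemma he_succ {R : Type*} [CommRing R] (x : R) (a : ℕ) :
    he x (a + 1) = x * he x a - a * he x (a - 1) := by
  cases a with
  | zero => simp [he]
  | succ a => simp [he]

lemma derivation_he {R A : Type*} [CommRing R] [CommRing A] [Algebra R A] (D : Derivation R A A)
    (x : A) (a : ℕ) : D (he x a) = a * he x (a - 1) * D x := by
  induction a using Nat.twoStepInduction with
  | zero => simp [he]
  | one => simp [he]
  | more a ih1 ih2 =>
    have h := he_succ x a
    have hD : D ((a : A) + 1) = 0 := by
      simp
    simp only [he, map_sub, Derivation.leibniz, ih1, ih2, hD, smul_eq_mul]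
    push_cast
    rw [h]
    ring

/-- The expectation of `He_a(g₁) He_b(g₂) He_c(g₃) He_d(g₄)` for a centered Gaussian vector with
unit variances and covariances `p₁₂, …, p₃₄`, computed by Wick's rule. -/
def wick {R : Type*} [CommRing R] (p₁₂ p₁₃ p₁₄ p₂₃ p₂₄ p₃₄ : R) : ℕ → ℕ → ℕ → ℕ → R
  | a + 1, b, c, d =>
      b * p₁₂ * wick p₁₂ p₁₃ p₁₄ p₂₃ p₂₄ p₃₄ a (b - 1) c d +
      c * p₁₃ * wick p₁₂ p₁₃ p₁₄ p₂₃ p₂₄ p₃₄ a b (c - 1) d +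
      d * p₁₄ * wick p₁₂ p₁₃ p₁₄ p₂₃ p₂₄ p₃₄ a b c (d - 1)
  | 0, b + 1, c, d =>
      c * p₂₃ * wick p₁₂ p₁₃ p₁₄ p₂₃ p₂₄ p₃₄ 0 b (c - 1) d +
      d * p₂₄ * wick p₁₂ p₁₃ p₁₄ p₂₃ p₂₄ p₃₄ 0 b c (d - 1)
  | 0, 0, c + 1, d => d * p₃₄ * wick p₁₂ p₁₃ p₁₄ p₂₃ p₂₄ p₃₄ 0 0 c (d - 1)
  | 0, 0, 0, _ + 1 => 0
  | 0, 0, 0, 0 => 1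
termination_by a b c d => a + b + c + d
decreasing_by all_goals omega

lemma map_wick {R S : Type*} [CommRing R] [CommRing S] (φ : R →+* S)
    (p₁₂ p₁₃ p₁₄ p₂₃ p₂₄ p₃₄ : R) (a b c d : ℕ) :
    φ (wick p₁₂ p₁₃ p₁₄ p₂₃ p₂₄ p₃₄ a b c d) =
      wick (φ p₁₂) (φ p₁₃) (φ p₁₄) (φ p₂₃) (φ p₂₄) (φ p₃₄) a b c d := by
  fun_induction wick p₁₂ p₁₃ p₁₄ p₂₃ p₂₄ p₃₄ a b c d <;> simp_all [wick]

section limits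

variable {n : ℕ} {M X : Matrix (Fin n) (Fin n) ℝ}

/-- Stein's identity for `He_a * P`: since `X i i = 1`, the derivative of `He_a` contributes
precisely the term subtracted in `He_{a+1}`. Hence no factor is ever paired with itself. -/
lemma tendsto_polyMean_he (hM : M * M.transpose = X) (hX : ∀ i, X i i = 1) (i : Fin n) (a : ℕ)
    {P : MvPolynomial (Fin n) ℝ} {v : ℝ}
    (h : Filter.Tendsto (fun m => polyMean M m (he (MvPolynomial.X i) a * dirDeriv (X i) P))
      Filter.atTop (nhds v)) :
    Filter.Tendsto (fun m => polyMean M m (he (MvPolynomial.X i) (a + 1) * P))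
      Filter.atTop (nhds v) := by
  have h1 := (tendsto_polyMean_stein hM hX i (he (MvPolynomial.X i) a * P)).add h
  rw [zero_add] at h1
  refine h1.congr fun m => ?_
  rw [← map_sub, ← map_add]
  congr 1
  rw [he_succ, Derivation.leibniz, derivation_he, dirDeriv_X, hX]
  simp only [smul_eq_mul, map_one]
  ring

lemma tendsto_polyMean_wick (hM : M * M.transpose = X) (hX : ∀ i, X i i = 1) (i j k l : Fin n)
    (a b c d : ℕ) :
    Filter.Tendsto (fun m => polyMean M m (he (MvPolynomial.X i) a * (he (MvPolynomial.X j) b *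
      (he (MvPolynomial.X k) c * he (MvPolynomial.X l) d)))) Filter.atTop
      (nhds (wick (X i j) (X i k) (X i l) (X j k) (X j l) (X k l) a b c d)) := by
  have hnat : ∀ (a : ℕ) (m : ℕ) (r : ℝ) (P : MvPolynomial (Fin n) ℝ),
      polyMean M m ((a : MvPolynomial (Fin n) ℝ) * MvPolynomial.C r * P) =
        a * r * polyMean M m P := by
    intro a m r P
    have : (a : MvPolynomial (Fin n) ℝ) * MvPolynomial.C r * P = ((a : ℝ) * r) • P := by
      rw [MvPolynomial.smul_eq_C_mul, map_mul, MvPolynomial.C_eq_coe_nat]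
    rw [this, map_smul, smul_eq_mul]
  fun_induction wick (X i j) (X i k) (X i l) (X j k) (X j l) (X k l) a b c d with
  | case1 a b c d ih1 ih2 ih3 =>
    refine tendsto_polyMean_he hM hX i a ?_
    refine (((ih1.const_mul (b * X i j)).add (ih2.const_mul (c * X i k))).add
      (ih3.const_mul (d * X i l))).congr fun m => ?_
    rw [← hnat, ← hnat, ← hnat, ← map_add, ← map_add]
    congr 1
    simp only [Derivation.leibniz, derivation_he, dirDeriv_X, smul_eq_mul]
    ring
  | case2 b c d ih1 ih2 =>
    simp only [he, one_mul] at ih1 ih2 ⊢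
    refine tendsto_polyMean_he hM hX j b ?_
    refine ((ih1.const_mul (c * X j k)).add (ih2.const_mul (d * X j l))).congr fun m => ?_
    rw [← hnat, ← hnat, ← map_add]
    congr 1
    simp only [Derivation.leibniz, derivation_he, dirDeriv_X, smul_eq_mul]
    ring
  | case3 c d ih1 =>
    simp only [he, one_mul] at ih1 ⊢
    refine tendsto_polyMean_he hM hX k c ?_
    refine (ih1.const_mul (d * X k l)).congr fun m => ?_
    rw [← hnat]
    congr 1
    simp only [derivation_he, dirDeriv_X]
    ring
  | case4 d =>
    simp only [he, one_mul]
    have := tendsto_polyMean_he hM hX l d (P := 1) (v := 0) (by simp)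
    simpa using this
  | case5 =>
    simp only [he, one_mul]
    simp [polyMean]

/-- The limiting seed polynomial, in terms of Hermite polynomials. -/
noncomputable def hermiteSeed (i : Fin n) : MvPolynomial (Fin n) ℝ :=
  he (MvPolynomial.X i) 1 - MvPolynomial.C (1 / 3) * he (MvPolynomial.X i) 3

lemma eval_hermiteSeed (x : Fin n → ℝ) (i : Fin n) :
    MvPolynomial.eval x (hermiteSeed i) = 2 * x i - x i ^ 3 / 3 := by
  simp [hermiteSeed, he]
  ring

lemma seed_eq {κ : ℕ} (A : Matrix (Fin n) (Fin κ) ℝ) (i : Fin n) (hA : ∑ j, A i j ^ 2 = 1)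
    (z : Fin κ → ℤˣ) :
    seed A i z = MvPolynomial.eval (radSum A z) (hermiteSeed i) +
      -(2 / 3 * ∑ j, (A i j * ((z j : ℤ) : ℝ)) ^ 3) := by
  have h := six_mul_esymm_three (fun j => A i j * ((z j : ℤ) : ℝ)) Finset.univ
  simp only [mul_pow _ _ 2, unit_cast_sq, mul_one, hA] at h
  rw [eval_hermiteSeed, seed, radSum]
  linear_combination -(1 / 3) * h

/-- In `2 + |u i|`, the part `1 + |u i|` bounds a perturbed factor, and the extra `1` pays for
replacing that factor. -/
lemma abs_prod_add_sub_prod_le {ι : Type*} (s : Finset ι) (u v : ι → ℝ) {ε : ℝ} (hε0 : 0 ≤ ε)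
    (hε : ε ≤ 1) (hv : ∀ i ∈ s, |v i| ≤ ε) :
    |∏ i ∈ s, (u i + v i) - ∏ i ∈ s, u i| ≤ ε * ∏ i ∈ s, (2 + |u i|) := by
  classical
  induction s using Finset.induction_on with
  | empty => simpa using hε0
  | insert x s hx ih =>
    rw [Finset.prod_insert hx, Finset.prod_insert hx, Finset.prod_insert hx]
    have ih := ih fun i hi => hv i (Finset.mem_insert_of_mem hi)
    have hvx := hv x (Finset.mem_insert_self _ _)
    have h1 : |∏ i ∈ s, u i| ≤ ∏ i ∈ s, (2 + |u i|) := by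
      rw [Finset.abs_prod]
      exact Finset.prod_le_prod (fun _ _ => abs_nonneg _) fun i _ => by linarith
    have e : (u x + v x) * ∏ i ∈ s, (u i + v i) - u x * ∏ i ∈ s, u i =
        (u x + v x) * (∏ i ∈ s, (u i + v i) - ∏ i ∈ s, u i) + v x * ∏ i ∈ s, u i := by ring
    rw [e]
    refine (abs_add_le _ _).trans ?_
    rw [abs_mul, abs_mul]
    have h2 : |u x + v x| ≤ |u x| + 1 := (abs_add_le _ _).trans (by linarith)
    have h3 := mul_le_mul h2 ih (abs_nonneg _) (by positivity)
    have h4 := mul_le_mul hvx h1 (abs_nonneg _) hε0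
    linarith

lemma tendsto_seedMoment_sub (hM : M * M.transpose = X) (hX : ∀ i, X i i = 1)
    (U : Finset (Fin n)) :
    Filter.Tendsto (fun m => seedMoment M U m - polyMean M m (∏ i ∈ U, hermiteSeed i))
      Filter.atTop (nhds 0) := by
  obtain ⟨c, hc, hA⟩ := abs_spread_le M
  obtain ⟨B, hB, hw⟩ := expect_weight_le n (3 * U.card)
  have hlim : Filter.Tendsto (fun m : ℕ => 4 ^ U.card * B * (c / √(2 ^ m)))
      Filter.atTop (nhds 0) := by
    simpa using (tendsto_div_sqrt_two_pow c).const_mul (4 ^ U.card * B)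
  refine squeeze_zero_norm' ?_ hlim
  have hsmall : ∀ᶠ m : ℕ in Filter.atTop, c / √(2 ^ m) < 1 :=
    (tendsto_div_sqrt_two_pow c).eventually_lt_const (by norm_num)
  have hbig : ∀ᶠ m : ℕ in Filter.atTop, n ≤ 2 ^ m :=
    (tendsto_pow_atTop_atTop_of_one_lt (one_lt_two (α := ℕ))).eventually_ge_atTop n
  filter_upwards [hsmall, hbig] with m h1 h2
  have hrow : ∀ i, ∑ j, spread M m i j ^ 2 = 1 := by
    intro i
    have := congrFun (congrFun (spread_mul_transpose M h2) i) i
    rw [hM, hX, Matrix.mul_apply] at this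
    simp only [Matrix.transpose_apply] at this
    rw [← this]
    exact Finset.sum_congr rfl fun j _ => sq _
  set ε := c / √(2 ^ m) with hε
  have hε0 : 0 ≤ ε := by positivity
  have hv : ∀ (z : Fin (2 ^ m) → ℤˣ) i,
      |-(2 / 3 * ∑ j, (spread M m i j * ((z j : ℤ) : ℝ)) ^ 3)| ≤ ε := by
    intro z i
    rw [abs_neg, abs_mul]
    have h3 : |∑ j, (spread M m i j * ((z j : ℤ) : ℝ)) ^ 3| ≤ ε := by
      refine (Finset.abs_sum_le_sum_abs _ _).trans ?_
      calc _ ≤ ∑ j, ε * spread M m i j ^ 2 := Finset.sum_le_sum fun j _ => by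
            rw [abs_pow, abs_mul, abs_unit_cast, mul_one, pow_succ, sq_abs, mul_comm]
            exact mul_le_mul_of_nonneg_right (hA m i j) (sq_nonneg _)
        _ = ε := by rw [← Finset.mul_sum, hrow, mul_one]
    rw [abs_of_nonneg (by norm_num : (0 : ℝ) ≤ 2 / 3)]
    linarith [abs_nonneg (∑ j, (spread M m i j * ((z j : ℤ) : ℝ)) ^ 3)]
  have hu : ∀ x : Fin n → ℝ, ∏ i ∈ U, (2 + |MvPolynomial.eval x (hermiteSeed i)|) ≤
      4 ^ U.card * (1 + ‖x‖) ^ (3 * U.card) := by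
    intro x
    rw [pow_mul, ← mul_pow, ← Finset.prod_const]
    refine Finset.prod_le_prod (fun _ _ => by positivity) fun i _ => ?_
    have hx : |x i| ≤ ‖x‖ := norm_le_pi_norm x i
    rw [eval_hermiteSeed]
    have t1 : |2 * x i - x i ^ 3 / 3| ≤ 2 * |x i| + |x i| ^ 3 / 3 := by
      refine (abs_sub _ _).trans_eq ?_
      rw [abs_mul, abs_div, abs_pow, abs_two, abs_of_nonneg (by norm_num : (0 : ℝ) ≤ 3)]
    have t2 : |x i| ^ 3 ≤ ‖x‖ ^ 3 := by gcongr
    nlinarith [norm_nonneg x, pow_nonneg (norm_nonneg x) 2, pow_nonneg (norm_nonneg x) 3]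
  rw [Real.norm_eq_abs]
  change |𝔼 z, ∏ i ∈ U, seed (spread M m) i z -
    𝔼 z, MvPolynomial.eval (radSum (spread M m) z) (∏ i ∈ U, hermiteSeed i)| ≤ _
  rw [← Finset.expect_sub_distrib]
  have hpt : ∀ z : Fin (2 ^ m) → ℤˣ, |∏ i ∈ U, seed (spread M m) i z -
      MvPolynomial.eval (radSum (spread M m) z) (∏ i ∈ U, hermiteSeed i)| ≤
      4 ^ U.card * ε * (1 + ‖radSum (spread M m) z‖) ^ (3 * U.card) := by
    intro z
    rw [map_prod, Finset.prod_congr rfl fun i _ => seed_eq (spread M m) i (hrow i) z]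
    refine (abs_prod_add_sub_prod_le U _ _ hε0 h1.le fun i _ => hv z i).trans ?_
    have := mul_le_mul_of_nonneg_left (hu (radSum (spread M m) z)) hε0
    linarith
  refine (abs_expect_le hpt).trans ?_
  rw [← Finset.mul_expect]
  have := mul_le_mul_of_nonneg_left (hw _ (spread M m) fun i => (hrow i).le)
    (show 0 ≤ 4 ^ U.card * ε by positivity)
  linarith

/-- Seeds are odd in `z`, and `z ↦ -z` preserves the measure. -/
lemma seedMoment_eq_zero_of_odd (M : Matrix (Fin n) (Fin n) ℝ) {U : Finset (Fin n)}
    (hU : Odd U.card) (m : ℕ) : seedMoment M U m = 0 := by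
  have hseed : ∀ i (z : Fin (2 ^ m) → ℤˣ),
      seed (spread M m) i (-z) = -seed (spread M m) i z := by
    intro i z
    have h3 : ∑ J ∈ Finset.powersetCard 3 Finset.univ,
        ∏ j ∈ J, spread M m i j * (((-z) j : ℤ) : ℝ) =
        -∑ J ∈ Finset.powersetCard 3 Finset.univ,
          ∏ j ∈ J, spread M m i j * ((z j : ℤ) : ℝ) := by
      rw [← Finset.sum_neg_distrib]
      refine Finset.sum_congr rfl fun J hJ => ?_
      have e : ∀ j, spread M m i j * (((-z) j : ℤ) : ℝ) =
          -1 * (spread M m i j * ((z j : ℤ) : ℝ)) := fun j => by simp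
      simp only [e]
      rw [Finset.prod_mul_distrib, Finset.prod_const, (Finset.mem_powersetCard.1 hJ).2]
      ring
    rw [seed, h3, seed]
    simp
    ring
  have h : seedMoment M U m = -seedMoment M U m := by
    rw [seedMoment, ← Finset.expect_neg_distrib]
    refine Fintype.expect_equiv (Equiv.neg _) _ _ fun z => ?_
    simp only [Equiv.neg_apply, hseed]
    rw [Finset.prod_neg, hU.neg_one_pow]
    ring
  linarith

end limits

/-- The functional sending `He_a` to `f a`, applied to the limiting seed polynomial. -/
def seedComb {R : Type*} [CommRing R] [Algebra ℚ R] (f : ℕ → R) : R :=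
  f 1 - algebraMap ℚ R (1 / 3) * f 3

/-- Limiting moment of four seed polynomials. -/
def quartMoment {R : Type*} [CommRing R] [Algebra ℚ R] (p₁₂ p₁₃ p₁₄ p₂₃ p₂₄ p₃₄ : R) : R :=
  seedComb fun a => seedComb fun b => seedComb fun c => seedComb fun d =>
    wick p₁₂ p₁₃ p₁₄ p₂₃ p₂₄ p₃₄ a b c d

lemma map_quartMoment {R S : Type*} [CommRing R] [CommRing S] [Algebra ℚ R] [Algebra ℚ S]
    (φ : R →ₐ[ℚ] S) (p₁₂ p₁₃ p₁₄ p₂₃ p₂₄ p₃₄ : R) :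
    φ (quartMoment p₁₂ p₁₃ p₁₄ p₂₃ p₂₄ p₃₄) =
      quartMoment (φ p₁₂) (φ p₁₃) (φ p₁₄) (φ p₂₃) (φ p₂₄) (φ p₃₄) := by
  have h := map_wick (φ : R →+* S) p₁₂ p₁₃ p₁₄ p₂₃ p₂₄ p₃₄
  simp only [RingHom.coe_coe] at h
  simp only [quartMoment, seedComb, map_sub, map_mul, h, AlgHom.commutes]

/-- Limiting moment of two seed polynomials. -/
noncomputable def pairMoment (p : ℝ) : ℝ := p + 2 / 3 * p ^ 3

section limits

variable {n : ℕ} {M X : Matrix (Fin n) (Fin n) ℝ}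

/-- Passes from one Hermite factor to one seed; nesting it treats products of several seeds. -/
lemma tendsto_seedComb {F : ℕ → MvPolynomial (Fin n) ℝ} {g : ℕ → ℝ}
    (h : ∀ a, Filter.Tendsto (fun m => polyMean M m (F a)) Filter.atTop (nhds (g a))) :
    Filter.Tendsto (fun m => polyMean M m (F 1 - MvPolynomial.C (1 / 3) * F 3)) Filter.atTop
      (nhds (seedComb g)) := by
  have := (h 1).sub ((h 3).const_mul (1 / 3))
  simp only [seedComb]
  convert this using 2
  · rw [← MvPolynomial.smul_eq_C_mul, map_sub, map_smul, smul_eq_mul]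
  · simp

lemma tendsto_seedMoment_quart (hM : M * M.transpose = X) (hX : ∀ i, X i i = 1)
    (e : Fin 4 ↪ Fin n) :
    Filter.Tendsto (seedMoment M (Finset.univ.map e)) Filter.atTop
      (nhds (quartMoment (X (e 0) (e 1)) (X (e 0) (e 2)) (X (e 0) (e 3)) (X (e 1) (e 2))
        (X (e 1) (e 3)) (X (e 2) (e 3)))) := by
  have h1 := tendsto_seedComb fun a => tendsto_seedComb fun b => tendsto_seedComb fun c =>
    tendsto_seedComb fun d =>
      tendsto_polyMean_wick hM hX (e 0) (e 1) (e 2) (e 3) a b c d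
  have h2 := (tendsto_seedMoment_sub hM hX (Finset.univ.map e)).add h1
  rw [zero_add] at h2
  refine h2.congr fun m => ?_
  rw [sub_add, ← map_sub]
  convert sub_zero _ using 2
  rw [Finset.prod_map, Fin.prod_univ_four]
  convert map_zero (polyMean M m) using 2
  simp only [hermiteSeed]
  ring

lemma tendsto_seedMoment_pair (hM : M * M.transpose = X) (hX : ∀ i, X i i = 1)
    (e : Fin 2 ↪ Fin n) :
    Filter.Tendsto (seedMoment M (Finset.univ.map e)) Filter.atTop
      (nhds (pairMoment (X (e 0) (e 1)))) := by
  -- The last two slots are placeholders: their degree is `0` and `He₀ = 1`.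
  have h1 := tendsto_seedComb fun a => tendsto_seedComb fun b =>
      tendsto_polyMean_wick hM hX (e 0) (e 1) (e 0) (e 1) a b 0 0
  have h2 := (tendsto_seedMoment_sub hM hX (Finset.univ.map e)).add h1
  rw [zero_add] at h2
  convert h2 using 1
  · funext m
    rw [sub_add, ← map_sub]
    symm
    convert sub_zero _ using 2
    rw [Finset.prod_map, Fin.prod_univ_two]
    convert map_zero (polyMean M m) using 2
    simp only [hermiteSeed, he]
    ring
  · congr 1
    simp [seedComb, wick, pairMoment]
    ring

end limits

/-! ### Decomposition of the fourth moments by Wick degree -/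

/-- Contribution of the Wick degrees `0` and `2` to the moment of four seed polynomials. -/
noncomputable def lowPart (p₁₂ p₁₃ p₁₄ p₂₃ p₂₄ p₃₄ : ℝ) : ℝ :=
  pairMoment p₁₂ * pairMoment p₃₄ +
    ((1 + 2 * p₁₂ ^ 2) * (1 + 2 * p₃₄ ^ 2) * (p₁₃ * p₂₄ + p₁₄ * p₂₃)
      - 2 * p₃₄ * (1 + 2 * p₁₂ ^ 2) * (p₁₃ * p₂₃ + p₁₄ * p₂₄)
      - 2 * p₁₂ * (1 + 2 * p₃₄ ^ 2) * (p₁₃ * p₁₄ + p₂₃ * p₂₄)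
      + 2 * p₁₂ * p₃₄ * (p₁₃ ^ 2 + p₁₄ ^ 2 + p₂₃ ^ 2 + p₂₄ ^ 2))

/-- Contribution of the Wick degrees `4` and `6` to the moment of four seed polynomials. -/
noncomputable def highPart (p₁₂ p₁₃ p₁₄ p₂₃ p₂₄ p₃₄ : ℝ) : ℝ :=
  2 / 3 * (p₁₃ ^ 3 * p₂₄ + p₂₃ ^ 3 * p₁₄ + p₁₄ ^ 3 * p₂₃ + p₂₄ ^ 3 * p₁₃)
    + 2 * (p₁₃ ^ 2 * p₁₄ * p₂₃ + p₂₃ ^ 2 * p₂₄ * p₁₃ + p₁₄ ^ 2 * p₁₃ * p₂₄ + p₂₄ ^ 2 * p₂₃ * p₁₄)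
    - 4 * (p₃₄ * (p₁₄ ^ 2 * p₁₃ * p₂₃ + p₂₄ ^ 2 * p₂₃ * p₁₃ + p₁₃ ^ 2 * p₁₄ * p₂₄
        + p₂₃ ^ 2 * p₂₄ * p₁₄)
      + p₁₂ * (p₂₃ ^ 2 * p₁₃ * p₁₄ + p₂₄ ^ 2 * p₁₄ * p₁₃ + p₁₃ ^ 2 * p₂₃ * p₂₄
        + p₁₄ ^ 2 * p₂₄ * p₂₃))
    + 4 * (p₁₂ * p₃₄ * (p₁₃ ^ 2 * p₂₄ ^ 2) + p₁₂ * p₃₄ * (p₂₃ ^ 2 * p₁₄ ^ 2))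
    + 16 * (p₁₂ * p₃₄ * (p₁₃ * p₂₄ * (p₁₄ * p₂₃)))
    + 4 / 9 * (p₁₃ ^ 3 * p₂₄ ^ 3 + p₂₃ ^ 3 * p₁₄ ^ 3)
    + 4 * (p₁₃ ^ 2 * p₂₄ ^ 2 * (p₁₄ * p₂₃) + p₂₃ ^ 2 * p₁₄ ^ 2 * (p₂₄ * p₁₃))

/-- Wick pairings are sorted by the number of edges between `{1, 2}` and `{3, 4}`, which is `0` or
`2` in the low part and `4` or `6` in the high part. -/
lemma quartMoment_eq (p₁₂ p₁₃ p₁₄ p₂₃ p₂₄ p₃₄ : ℝ) :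
    quartMoment p₁₂ p₁₃ p₁₄ p₂₃ p₂₄ p₃₄ =
      lowPart p₁₂ p₁₃ p₁₄ p₂₃ p₂₄ p₃₄ + highPart p₁₂ p₁₃ p₁₄ p₂₃ p₂₄ p₃₄ := by
  simp [quartMoment, seedComb, wick, lowPart, highPart, pairMoment]
  ring

/-- In `lowPart a 1 b a c b` the monomial `a * b` occurs with coefficient `1 + 1 - 2 - 2 + 2 = 0`.
For a seed `He₁ - θ He₃` it would be `2 (1 - 3θ)²`, so `θ = 1/3` is forced. All that remains has a
spare factor of order `δ` beside `c ^ 2` or `a * b`. -/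
lemma abs_pairMoment_sub_lowPart_le {δ a b c : ℝ} (hδ : δ ≤ 1) (ha : |a| ≤ δ) (hb : |b| ≤ δ)
    (hc : |c| ≤ δ) :
    |pairMoment c - lowPart a 1 b a c b| ≤ δ * (|c| * |c|) + 12 * (δ * (|b| * |a|)) := by
  have h : pairMoment c - lowPart a 1 b a c b = 2 / 3 * c ^ 3 +
      -(b * a) * (2 / 3 * a ^ 2 + 2 / 3 * b ^ 2 + 40 / 9 * (a ^ 2 * b ^ 2) + 2 * c ^ 2
        - 4 * (a * b * c)) := by
    simp only [lowPart, pairMoment]; ring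
  have hδ0 : 0 ≤ δ := (abs_nonneg a).trans ha
  have sq : ∀ x, |x| ≤ δ → x ^ 2 ≤ δ := fun x hx => by
    rw [← sq_abs]; nlinarith [abs_nonneg x]
  have ha2 := sq a ha
  have hb2 := sq b hb
  have hc2 := sq c hc
  have hab : a ^ 2 * b ^ 2 ≤ δ := by nlinarith [sq_nonneg a, sq_nonneg b]
  have habc : |a * b * c| ≤ δ := by
    rw [abs_mul, abs_mul]
    calc |a| * |b| * |c| ≤ 1 * 1 * δ := by gcongr <;> linarith
      _ = δ := by ring
  have ht : |2 / 3 * a ^ 2 + 2 / 3 * b ^ 2 + 40 / 9 * (a ^ 2 * b ^ 2) + 2 * c ^ 2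
        - 4 * (a * b * c)| ≤ 12 * δ := by
    have := abs_le.1 habc
    rw [abs_le]
    constructor <;> nlinarith [sq_nonneg a, sq_nonneg b, sq_nonneg c,
      mul_nonneg (sq_nonneg a) (sq_nonneg b)]
  rw [h]
  refine (abs_add_le _ _).trans (add_le_add ?_ ?_)
  · rw [abs_mul, abs_pow, abs_of_nonneg (by norm_num : (0 : ℝ) ≤ 2 / 3)]
    have : |c| * (|c| * |c|) ≤ δ * (|c| * |c|) := by gcongr
    nlinarith [mul_nonneg (abs_nonneg c) (mul_nonneg (abs_nonneg c) (abs_nonneg c))]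
  · rw [abs_mul, abs_neg, abs_mul]
    have := mul_le_mul_of_nonneg_left ht (mul_nonneg (abs_nonneg b) (abs_nonneg a))
    linarith

lemma abs_one_sub_lowPart_le {δ a : ℝ} (hδ : δ ≤ 1) (ha : |a| ≤ δ) :
    |1 - lowPart a 1 a a 1 a| ≤ 10 * δ := by
  have h : 1 - lowPart a 1 a a 1 a =
      -(a ^ 2 * (2 - 8 / 3 * a ^ 2 + 40 / 9 * (a ^ 2 * a ^ 2))) := by
    simp only [lowPart, pairMoment]; ring
  have hδ0 : 0 ≤ δ := (abs_nonneg a).trans ha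
  have ha2 : a ^ 2 ≤ δ := by rw [← sq_abs]; nlinarith [abs_nonneg a]
  have ha4 : a ^ 2 * a ^ 2 ≤ 1 := by nlinarith [sq_nonneg a]
  rw [h, abs_neg, abs_mul, abs_of_nonneg (sq_nonneg a)]
  have : |2 - 8 / 3 * a ^ 2 + 40 / 9 * (a ^ 2 * a ^ 2)| ≤ 10 := by
    rw [abs_le]; constructor <;> nlinarith [sq_nonneg a, mul_nonneg (sq_nonneg a) (sq_nonneg a)]
  calc _ ≤ δ * 10 := mul_le_mul ha2 this (abs_nonneg _) hδ0
    _ = _ := by ring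

/-! ### Quartic sums -/

section quadSum

variable {ι : Type*} [Fintype ι]

/-- The value at `c` of the quadratic form on matrices with kernel `e`. -/
def quadSum (c : ι → ι → ℝ) (e : ι → ι → ι → ι → ℝ) : ℝ :=
  ∑ i, ∑ j, ∑ k, ∑ l, c i j * c k l * e i j k l

lemma quadSum_add (c : ι → ι → ℝ) (e f : ι → ι → ι → ι → ℝ) :
    quadSum c (fun i j k l => e i j k l + f i j k l) = quadSum c e + quadSum c f := by
  simp only [quadSum, mul_add, Finset.sum_add_distrib]

lemma quadSum_sub (c : ι → ι → ℝ) (e f : ι → ι → ι → ι → ℝ) :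
    quadSum c (fun i j k l => e i j k l - f i j k l) = quadSum c e - quadSum c f := by
  simp only [quadSum, mul_sub, Finset.sum_sub_distrib]

lemma quadSum_mul (c : ι → ι → ℝ) (a : ℝ) (e : ι → ι → ι → ι → ℝ) :
    quadSum c (fun i j k l => a * e i j k l) = a * quadSum c e := by
  simp only [quadSum, Finset.mul_sum]
  exact Finset.sum_congr rfl fun i _ => Finset.sum_congr rfl fun j _ =>
    Finset.sum_congr rfl fun k _ => Finset.sum_congr rfl fun l _ => by ring

lemma quadSum_congr {c : ι → ι → ℝ} (hc : ∀ i, c i i = 0) {e f : ι → ι → ι → ι → ℝ}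
    (h : ∀ i j k l, i ≠ j → k ≠ l → e i j k l = f i j k l) : quadSum c e = quadSum c f := by
  refine Finset.sum_congr rfl fun i _ => Finset.sum_congr rfl fun j _ =>
    Finset.sum_congr rfl fun k _ => Finset.sum_congr rfl fun l _ => ?_
  by_cases hij : i = j
  · subst hij; simp [hc]
  by_cases hkl : k = l
  · subst hkl; simp [hc]
  rw [h i j k l hij hkl]

lemma quadSum_swap_left {c : ι → ι → ℝ} (hc : ∀ i j, c i j = c j i) (e : ι → ι → ι → ι → ℝ) :
    quadSum c (fun i j k l => e j i k l) = quadSum c e := by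
  unfold quadSum
  rw [Finset.sum_comm]
  exact Finset.sum_congr rfl fun i _ => Finset.sum_congr rfl fun j _ =>
    Finset.sum_congr rfl fun k _ => Finset.sum_congr rfl fun l _ => by rw [hc j i]

lemma quadSum_swap_pairs (c : ι → ι → ℝ) (e : ι → ι → ι → ι → ℝ) :
    quadSum c (fun i j k l => e k l i j) = quadSum c e := by
  unfold quadSum
  calc _ = ∑ i, ∑ k, ∑ j, ∑ l, c i j * c k l * e k l i j :=
        Finset.sum_congr rfl fun i _ => Finset.sum_comm
    _ = ∑ k, ∑ i, ∑ l, ∑ j, c i j * c k l * e k l i j := by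
        rw [Finset.sum_comm]
        exact Finset.sum_congr rfl fun i _ => Finset.sum_congr rfl fun k _ => Finset.sum_comm
    _ = ∑ k, ∑ l, ∑ i, ∑ j, c i j * c k l * e k l i j :=
        Finset.sum_congr rfl fun i _ => Finset.sum_comm
    _ = _ := by simp only [mul_comm (c _ _) (c _ _)]

lemma quadSum_swap_right {c : ι → ι → ℝ} (hc : ∀ i j, c i j = c j i) (e : ι → ι → ι → ι → ℝ) :
    quadSum c (fun i j k l => e i j l k) = quadSum c e := by
  rw [← quadSum_swap_pairs c (fun i j k l => e i j l k), ← quadSum_swap_pairs c e]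
  exact quadSum_swap_left hc fun i j k l => e k l i j

/-- A weighted Schur test. -/
lemma abs_quadSum_le {c : ι → ι → ℝ} {e f g : ι → ι → ι → ι → ℝ} {δ R : ℝ} (hδ : 0 ≤ δ)
    (he : ∀ i j k l, |e i j k l| ≤ δ * (f i j k l * g i j k l))
    (hf : ∀ i j, ∑ k, ∑ l, f i j k l ^ 2 ≤ R) (hg : ∀ k l, ∑ i, ∑ j, g i j k l ^ 2 ≤ R) :
    |quadSum c e| ≤ δ * R * ∑ i, ∑ j, c i j ^ 2 := by
  have h1 : |quadSum c e| ≤ ∑ i, ∑ j, ∑ k, ∑ l,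
      (δ / 2 * (c i j ^ 2 * f i j k l ^ 2) + δ / 2 * (c k l ^ 2 * g i j k l ^ 2)) := by
    refine (Finset.abs_sum_le_sum_abs _ _).trans (Finset.sum_le_sum fun i _ => ?_)
    refine (Finset.abs_sum_le_sum_abs _ _).trans (Finset.sum_le_sum fun j _ => ?_)
    refine (Finset.abs_sum_le_sum_abs _ _).trans (Finset.sum_le_sum fun k _ => ?_)
    refine (Finset.abs_sum_le_sum_abs _ _).trans (Finset.sum_le_sum fun l _ => ?_)
    rw [abs_mul, abs_mul]
    have h2 := mul_le_mul_of_nonneg_left (he i j k l)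
      (mul_nonneg (abs_nonneg (c i j)) (abs_nonneg (c k l)))
    -- AM-GM pairs `f` with `c i j` and `g` with `c k l`, so that each is summed over the pair that
    -- its weight does not involve.
    have h3 := mul_nonneg hδ (sq_nonneg (|c i j| * f i j k l - |c k l| * g i j k l))
    have e1 := sq_abs (c i j)
    have e2 := sq_abs (c k l)
    rw [← e1, ← e2]
    linarith
  refine h1.trans ?_
  simp only [Finset.sum_add_distrib, ← Finset.mul_sum]
  have hA : ∑ i, ∑ j, c i j ^ 2 * ∑ k, ∑ l, f i j k l ^ 2 ≤ R * ∑ i, ∑ j, c i j ^ 2 := by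
    simp only [Finset.mul_sum (a := R)]
    refine Finset.sum_le_sum fun i _ => Finset.sum_le_sum fun j _ => ?_
    rw [mul_comm]
    exact mul_le_mul_of_nonneg_right (hf i j) (sq_nonneg _)
  have hB : ∑ i, ∑ j, ∑ k, ∑ l, c k l ^ 2 * g i j k l ^ 2 ≤ R * ∑ i, ∑ j, c i j ^ 2 := by
    have : ∑ i, ∑ j, ∑ k, ∑ l, c k l ^ 2 * g i j k l ^ 2 =
        ∑ k, ∑ l, c k l ^ 2 * ∑ i, ∑ j, g i j k l ^ 2 := by
      have := quadSum_swap_pairs (fun _ _ : ι => (1 : ℝ))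
        (fun k l i j => c k l ^ 2 * g i j k l ^ 2)
      simp only [quadSum, one_mul] at this
      rw [this]
      simp only [Finset.mul_sum]
    rw [this]
    simp only [Finset.mul_sum (a := R)]
    refine Finset.sum_le_sum fun i _ => Finset.sum_le_sum fun j _ => ?_
    rw [mul_comm]
    exact mul_le_mul_of_nonneg_right (hg i j) (sq_nonneg _)
  have := mul_le_mul_of_nonneg_left (add_le_add hA hB) (show 0 ≤ δ / 2 by positivity)
  linarith

end quadSum

/-- Indicator of disjointness of the pairs `{i, j}` and `{k, l}`. -/
def disj {ι : Type*} [DecidableEq ι] (i j k l : ι) : ℝ := if i = k ∨ i = l ∨ j = k ∨ j = l then 0 else 1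

lemma abs_disj_mul_le {ι : Type*} [DecidableEq ι] (i j k l : ι) (x : ℝ) : |disj i j k l * x| ≤ |x| := by
  unfold disj
  split_ifs
  · simp
  · simp

lemma disj_swap_left {ι : Type*} [DecidableEq ι] (i j k l : ι) : disj j i k l = disj i j k l := by
  unfold disj
  congr 1
  exact propext (by tauto)

lemma disj_swap_right {ι : Type*} [DecidableEq ι] (i j k l : ι) : disj i j l k = disj i j k l := by
  unfold disj
  congr 1
  exact propext (by tauto)

lemma disj_swap_pairs {ι : Type*} [DecidableEq ι] (i j k l : ι) : disj k l i j = disj i j k l := by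
  unfold disj
  congr 1
  exact propext (by
    rw [eq_comm (a := k), eq_comm (a := k), eq_comm (a := l), eq_comm (a := l)]
    tauto)

/-! ### Norm bounds for the kernels of high Wick degree and for overlapping pairs -/

section bounds

variable {ι : Type*} [Fintype ι]

/-- Hypotheses on the off-diagonal part `Y` of a correlation matrix: entries, rows and operator
norm are bounded in terms of `δ`, `r` and `s`. -/
structure OffDiagBound (Y : ι → ι → ℝ) (δ r s : ℝ) : Prop where
  diag : ∀ i, Y i i = 0
  symm : ∀ i j, Y i j = Y j i
  le_one : δ ≤ 1
  nonneg : 0 ≤ δ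
  entry : ∀ i j, |Y i j| ≤ δ
  row_nonneg : 0 ≤ r
  row : ∀ i, ∑ j, Y i j ^ 2 ≤ r
  op : ∀ v : ι → ℝ, ∑ i, (∑ j, Y i j * v j) ^ 2 ≤ s * ∑ j, v j ^ 2

variable {Y : ι → ι → ℝ} {δ r s : ℝ}

lemma OffDiagBound.abs_le_one (h : OffDiagBound Y δ r s) (i j : ι) : |Y i j| ≤ 1 :=
  (h.entry i j).trans h.le_one

lemma OffDiagBound.col (h : OffDiagBound Y δ r s) (j : ι) : ∑ i, Y i j ^ 2 ≤ r := by
  simp only [h.symm _ j]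
  exact h.row j

lemma sum_sq_mul_le {u v : ι → ℝ} (hu : ∑ k, u k ^ 2 ≤ r) (hv : ∑ l, v l ^ 2 ≤ r) :
    ∑ k, ∑ l, (|u k| * |v l|) ^ 2 ≤ r ^ 2 := by
  have : ∑ k, ∑ l, (|u k| * |v l|) ^ 2 = (∑ k, u k ^ 2) * ∑ l, v l ^ 2 := by
    rw [Finset.sum_mul_sum]
    simp only [mul_pow, sq_abs]
  rw [this, sq]
  have h0 : 0 ≤ ∑ k, u k ^ 2 := by positivity
  have h1 : 0 ≤ ∑ l, v l ^ 2 := by positivity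
  exact mul_le_mul hu hv h1 (h0.trans hu)

variable {c : ι → ι → ℝ}

/-- The edge `Y j l` occurs only to the first power and row sums of `|Y|` are not controlled, so
absolute values would lose too much. Summing over `j` before taking them applies `Y` to the rows of
`c`, at the cost of the operator norm. -/
lemma OffDiagBound.cube_term (h : OffDiagBound Y δ r s) :
    |quadSum c (fun i j k l => Y i k ^ 3 * Y j l)| ≤
      δ * (r * (1 + s) / 2) * ∑ i, ∑ j, c i j ^ 2 := by
  set D : ι → ι → ℝ := fun i l => ∑ j, Y l j * c i j with hD
  have e : quadSum c (fun i j k l => Y i k ^ 3 * Y j l) =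
      ∑ i, ∑ k, ∑ l, Y i k ^ 3 * (D i l * c k l) := by
    unfold quadSum
    refine Finset.sum_congr rfl fun i _ => ?_
    rw [Finset.sum_comm]
    refine Finset.sum_congr rfl fun k _ => ?_
    rw [Finset.sum_comm]
    refine Finset.sum_congr rfl fun l _ => ?_
    rw [hD, Finset.sum_mul, Finset.mul_sum]
    refine Finset.sum_congr rfl fun j _ => ?_
    rw [h.symm l j]
    ring
  rw [e]
  have h1 : |∑ i, ∑ k, ∑ l, Y i k ^ 3 * (D i l * c k l)| ≤
      ∑ i, ∑ k, ∑ l, (δ / 2 * (Y i k ^ 2 * D i l ^ 2) + δ / 2 * (Y i k ^ 2 * c k l ^ 2)) := by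
    refine (Finset.abs_sum_le_sum_abs _ _).trans (Finset.sum_le_sum fun i _ => ?_)
    refine (Finset.abs_sum_le_sum_abs _ _).trans (Finset.sum_le_sum fun k _ => ?_)
    refine (Finset.abs_sum_le_sum_abs _ _).trans (Finset.sum_le_sum fun l _ => ?_)
    have t1 : |Y i k ^ 3| ≤ δ * Y i k ^ 2 := by
      rw [abs_pow, pow_succ, sq_abs, mul_comm]
      exact mul_le_mul_of_nonneg_right (h.entry i k) (sq_nonneg _)
    have t2 : |D i l * c k l| ≤ (D i l ^ 2 + c k l ^ 2) / 2 := by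
      rw [abs_mul, ← sq_abs (D i l), ← sq_abs (c k l)]
      linarith [sq_nonneg (|D i l| - |c k l|)]
    rw [abs_mul]
    have := mul_le_mul t1 t2 (abs_nonneg _) (mul_nonneg h.nonneg (sq_nonneg _))
    linarith
  refine h1.trans ?_
  simp only [Finset.sum_add_distrib, ← Finset.mul_sum]
  have hDD : ∑ i, ∑ l, D i l ^ 2 ≤ s * ∑ i, ∑ j, c i j ^ 2 := by
    rw [Finset.mul_sum]
    exact Finset.sum_le_sum fun i _ => h.op (c i)
  have hA : ∑ i, ∑ k, Y i k ^ 2 * ∑ l, D i l ^ 2 ≤ r * ∑ i, ∑ l, D i l ^ 2 := by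
    rw [Finset.mul_sum]
    refine Finset.sum_le_sum fun i _ => ?_
    rw [← Finset.sum_mul]
    exact mul_le_mul_of_nonneg_right (h.row i) (by positivity)
  have hB : ∑ i, ∑ k, Y i k ^ 2 * ∑ l, c k l ^ 2 ≤ r * ∑ k, ∑ l, c k l ^ 2 := by
    rw [Finset.sum_comm, Finset.mul_sum]
    refine Finset.sum_le_sum fun i _ => ?_
    rw [← Finset.sum_mul]
    exact mul_le_mul_of_nonneg_right (h.col i) (by positivity)
  have hA' := hA.trans (mul_le_mul_of_nonneg_left hDD h.row_nonneg)
  have := mul_le_mul_of_nonneg_left (add_le_add hA' hB) (show 0 ≤ δ / 2 by linarith [h.nonneg])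
  linarith

/-- For fixed `i` and `k` the sums over `j` and `l` separate, and each applies `Y` to a row of `c`;
`Y i k ^ 2` supplies the factor `δ`. -/
lemma OffDiagBound.path_term (h : OffDiagBound Y δ r s) :
    |quadSum c (fun i j k l => Y i k ^ 2 * Y i l * Y j k)| ≤
      δ * s * ∑ i, ∑ j, c i j ^ 2 := by
  set D : ι → ι → ℝ := fun i l => ∑ j, Y l j * c i j with hD
  have e : quadSum c (fun i j k l => Y i k ^ 2 * Y i l * Y j k) =
      ∑ i, ∑ k, Y i k ^ 2 * (D i k * D k i) := by
    unfold quadSum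
    refine Finset.sum_congr rfl fun i _ => ?_
    rw [Finset.sum_comm]
    refine Finset.sum_congr rfl fun k _ => ?_
    rw [hD, Finset.sum_mul_sum, Finset.mul_sum]
    refine Finset.sum_congr rfl fun j _ => ?_
    rw [Finset.mul_sum]
    refine Finset.sum_congr rfl fun l _ => ?_
    simp only [h.symm j k]
    ring
  rw [e]
  have h1 : |∑ i, ∑ k, Y i k ^ 2 * (D i k * D k i)| ≤
      ∑ i, ∑ k, (δ / 2 * D i k ^ 2 + δ / 2 * D k i ^ 2) := by
    refine (Finset.abs_sum_le_sum_abs _ _).trans (Finset.sum_le_sum fun i _ => ?_)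
    refine (Finset.abs_sum_le_sum_abs _ _).trans (Finset.sum_le_sum fun k _ => ?_)
    have t1 : |Y i k ^ 2| ≤ δ := by
      rw [abs_pow, sq]
      nlinarith [h.entry i k, h.abs_le_one i k, abs_nonneg (Y i k)]
    have t2 : |D i k * D k i| ≤ (D i k ^ 2 + D k i ^ 2) / 2 := by
      rw [abs_mul, ← sq_abs (D i k), ← sq_abs (D k i)]
      linarith [sq_nonneg (|D i k| - |D k i|)]
    rw [abs_mul]
    have := mul_le_mul t1 t2 (abs_nonneg _) h.nonneg
    linarith
  refine h1.trans ?_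
  have hDD : ∑ i, ∑ l, D i l ^ 2 ≤ s * ∑ i, ∑ j, c i j ^ 2 := by
    rw [Finset.mul_sum]
    exact Finset.sum_le_sum fun i _ => h.op (c i)
  simp only [Finset.sum_add_distrib, ← Finset.mul_sum]
  rw [Finset.sum_comm (f := fun i k => D k i ^ 2)]
  have := mul_le_mul_of_nonneg_left hDD h.nonneg
  linarith

lemma OffDiagBound.abs_mul_le (h : OffDiagBound Y δ r s) (i j k l : ι) :
    |Y i j * Y k l| ≤ δ := by
  rw [abs_mul]
  calc |Y i j| * |Y k l| ≤ δ * 1 := by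
        gcongr
        · exact h.nonneg
        · exact h.entry i j
        · exact h.abs_le_one k l
    _ = δ := mul_one δ

variable [DecidableEq ι]

lemma OffDiagBound.disj_cube_term (h : OffDiagBound Y δ r s) (hc0 : ∀ i, c i i = 0) :
    |quadSum c (fun i j k l => disj i j k l * (Y i k ^ 3 * Y j l))| ≤
      δ * (r * (1 + s) / 2 + 2 * r) * ∑ i, ∑ j, c i j ^ 2 := by
  -- Coincidences `i = k` and `j = l` are excluded already by the zero diagonal of `Y`. Only `i = l`
  -- and `j = k` need removal, their intersection just once; there a Schur test suffices.
  have e : quadSum c (fun i j k l => disj i j k l * (Y i k ^ 3 * Y j l)) =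
      quadSum c (fun i j k l => Y i k ^ 3 * Y j l) -
        quadSum c (fun i j k l => if i = l then Y i k ^ 3 * Y j l else 0) -
        quadSum c (fun i j k l => if j = k then if i = l then 0 else Y i k ^ 3 * Y j l else 0) := by
    rw [← quadSum_sub, ← quadSum_sub]
    refine quadSum_congr hc0 fun i j k l hij hkl => ?_
    by_cases hik : i = k
    · subst hik; simp [h.diag]
    by_cases hjl : j = l
    · subst hjl; simp [h.diag]
    simp only [disj, hik, hjl, false_or, or_false]
    by_cases hil : i = l <;> by_cases hjk : j = k <;> simp [hil, hjk]
  have hprod : ∀ i j k l, |Y i k ^ 3 * Y j l| ≤ δ * (|Y i k| * |Y j l|) := by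
    intro i j k l
    rw [abs_mul, abs_pow]
    have h1 : |Y i k| ^ 3 ≤ δ * |Y i k| := by
      have := h.entry i k
      have h2 := h.abs_le_one i k
      have h0 := abs_nonneg (Y i k)
      calc |Y i k| ^ 3 = |Y i k| * |Y i k| * |Y i k| := by ring
        _ ≤ 1 * δ * |Y i k| := by gcongr
        _ = _ := by ring
    have := mul_le_mul_of_nonneg_right h1 (abs_nonneg (Y j l))
    linarith
  have h1 : |quadSum c (fun i j k l => if i = l then Y i k ^ 3 * Y j l else 0)| ≤
      δ * r * ∑ i, ∑ j, c i j ^ 2 := by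
    refine abs_quadSum_le (f := fun i j k l => if i = l then |Y i k| else 0)
      (g := fun i j k l => if i = l then |Y j l| else 0) h.nonneg ?_ ?_ ?_
    · intro i j k l
      split_ifs
      · exact hprod i j k l
      · simp
    · intro i j
      simpa [ite_pow] using h.row i
    · intro k l
      rw [Finset.sum_comm]
      simpa [ite_pow] using h.col l
  have h2 : |quadSum c (fun i j k l => if j = k then if i = l then 0 else Y i k ^ 3 * Y j l
      else 0)| ≤ δ * r * ∑ i, ∑ j, c i j ^ 2 := by
    refine abs_quadSum_le (f := fun i j k l => if j = k then |Y j l| else 0)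
      (g := fun i j k l => if j = k then |Y i k| else 0) h.nonneg ?_ ?_ ?_
    · intro i j k l
      split_ifs
      · simpa using mul_nonneg h.nonneg (by positivity)
      · rw [mul_comm |Y j l|]
        exact hprod i j k l
      · simp
    · intro i j
      rw [Finset.sum_comm]
      simpa [ite_pow] using h.row j
    · intro k l
      simpa [ite_pow] using h.col k
  have h3 := h.cube_term (c := c)
  rw [e]
  refine (abs_sub _ _).trans ?_
  have h4 := abs_sub (quadSum c (fun i j k l => Y i k ^ 3 * Y j l))
    (quadSum c (fun i j k l => if i = l then Y i k ^ 3 * Y j l else 0))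
  linarith

lemma OffDiagBound.disj_path_term (h : OffDiagBound Y δ r s) (hc0 : ∀ i, c i i = 0) :
    |quadSum c (fun i j k l => disj i j k l * (Y i k ^ 2 * Y i l * Y j k))| ≤
      δ * (s + r) * ∑ i, ∑ j, c i j ^ 2 := by
  -- The edges `ik`, `il`, `jk` vanish on their coincidences, which leaves `j = l` alone to remove.
  have e : quadSum c (fun i j k l => disj i j k l * (Y i k ^ 2 * Y i l * Y j k)) =
      quadSum c (fun i j k l => Y i k ^ 2 * Y i l * Y j k) -
        quadSum c (fun i j k l => if j = l then Y i k ^ 2 * Y i l * Y j k else 0) := by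
    rw [← quadSum_sub]
    refine quadSum_congr hc0 fun i j k l hij hkl => ?_
    by_cases hik : i = k
    · subst hik; simp [h.diag]
    by_cases hil : i = l
    · subst hil; simp [h.diag]
    by_cases hjk : j = k
    · subst hjk; simp [h.diag]
    by_cases hjl : j = l <;> simp [disj, hik, hjl, hil, hjk]
  have h1 : |quadSum c (fun i j k l => if j = l then Y i k ^ 2 * Y i l * Y j k else 0)| ≤
      δ * r * ∑ i, ∑ j, c i j ^ 2 := by
    refine abs_quadSum_le (f := fun i j k l => if j = l then |Y i k| else 0)
      (g := fun i j k l => if j = l then |Y i k| else 0) h.nonneg ?_ ?_ ?_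
    · intro i j k l
      split_ifs
      · rw [abs_mul, abs_mul, abs_pow]
        have t1 := h.abs_le_one j k
        have t2 := h.entry i l
        have t3 := h.nonneg
        calc |Y i k| ^ 2 * |Y i l| * |Y j k| ≤ |Y i k| ^ 2 * δ * 1 := by gcongr
          _ = _ := by ring
      · simp
    · intro i j
      simpa [ite_pow] using h.row i
    · intro k l
      simpa [ite_pow] using h.col k
  have h3 := h.path_term (c := c)
  rw [e]
  refine (abs_sub _ _).trans ?_
  linarith

/-- One entry pays for `δ`; the others split into two products whose squares sum to at most `r ^ 2`.
No operator norm is needed, and `disj` can be bounded by `1`. -/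
lemma OffDiagBound.disj_fork_term (h : OffDiagBound Y δ r s) :
    |quadSum c (fun i j k l => disj i j k l * (Y k l * (Y i l ^ 2 * Y i k * Y j k)))| ≤
      δ * r ^ 2 * ∑ i, ∑ j, c i j ^ 2 := by
  refine abs_quadSum_le (f := fun i j k l => |Y i k| * |Y i l|)
    (g := fun i j k l => |Y i l| * |Y j k|) h.nonneg ?_ ?_ ?_
  · intro i j k l
    refine (abs_disj_mul_le _ _ _ _ _).trans ?_
    simp only [abs_mul, abs_pow]
    have := mul_le_mul_of_nonneg_right (h.entry k l)
      (show 0 ≤ |Y i l| ^ 2 * |Y i k| * |Y j k| by positivity)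
    linarith
  · exact fun i j => sum_sq_mul_le (h.row i) (h.row i)
  · exact fun k l => sum_sq_mul_le (h.col l) (h.col k)

lemma OffDiagBound.disj_square_term (h : OffDiagBound Y δ r s) {a : ι → ι → ι → ι → ℝ}
    (ha : ∀ i j k l, |a i j k l| ≤ δ) :
    |quadSum c (fun i j k l => disj i j k l * (a i j k l * (Y i k ^ 2 * Y j l ^ 2)))| ≤
      δ * r ^ 2 * ∑ i, ∑ j, c i j ^ 2 := by
  refine abs_quadSum_le (f := fun i j k l => |Y i k| * |Y j l|)
    (g := fun i j k l => |Y i k| * |Y j l|) h.nonneg ?_ ?_ ?_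
  · intro i j k l
    refine (abs_disj_mul_le _ _ _ _ _).trans ?_
    rw [abs_mul, abs_mul, abs_pow, abs_pow]
    have := mul_le_mul_of_nonneg_right (ha i j k l)
      (show 0 ≤ |Y i k| ^ 2 * |Y j l| ^ 2 by positivity)
    linarith
  · exact fun i j => sum_sq_mul_le (h.row i) (h.row j)
  · exact fun k l => sum_sq_mul_le (h.col k) (h.col l)

lemma OffDiagBound.disj_cycle_term (h : OffDiagBound Y δ r s) :
    |quadSum c (fun i j k l =>
        disj i j k l * (Y i j * Y k l * (Y i k * Y j l * (Y i l * Y j k))))| ≤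
      δ * r ^ 2 * ∑ i, ∑ j, c i j ^ 2 := by
  refine abs_quadSum_le (f := fun i j k l => |Y i k| * |Y j l|)
    (g := fun i j k l => |Y i l| * |Y j k|) h.nonneg ?_ ?_ ?_
  · intro i j k l
    refine (abs_disj_mul_le _ _ _ _ _).trans ?_
    rw [abs_mul]
    refine mul_le_mul (h.abs_mul_le i j k l) ?_ (abs_nonneg _) h.nonneg
    simp only [abs_mul, le_refl]
  · exact fun i j => sum_sq_mul_le (h.row i) (h.row j)
  · exact fun k l => sum_sq_mul_le (h.col l) (h.col k)

/-- The high Wick degrees contribute a form of small norm on disjoint pairs. -/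
lemma OffDiagBound.disj_highPart (h : OffDiagBound Y δ r s) (hc0 : ∀ i, c i i = 0)
    (hcs : ∀ i j, c i j = c j i) :
    |quadSum c (fun i j k l => disj i j k l *
        highPart (Y i j) (Y i k) (Y i l) (Y j k) (Y j l) (Y k l))| ≤
      δ * (8 / 3 * (r * (1 + s) / 2 + 2 * r) + 8 * (s + r) + 65 * r ^ 2) *
        ∑ i, ∑ j, c i j ^ 2 := by
  -- One representative for each symmetry class of monomials under swapping within pairs and, for
  -- `q3`, also swapping the pairs. Since `c` is symmetric, all members of a class have the same
  -- `quadSum`.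
  set q1 : ι → ι → ι → ι → ℝ := fun i j k l => disj i j k l * (Y i k ^ 3 * Y j l) with hq1
  set q2 : ι → ι → ι → ι → ℝ := fun i j k l => disj i j k l * (Y i k ^ 2 * Y i l * Y j k) with hq2
  set q3 : ι → ι → ι → ι → ℝ :=
    fun i j k l => disj i j k l * (Y k l * (Y i l ^ 2 * Y i k * Y j k)) with hq3
  set q4 : ι → ι → ι → ι → ℝ :=
    fun i j k l => disj i j k l * (Y i j * Y k l * (Y i k ^ 2 * Y j l ^ 2)) with hq4
  set q5 : ι → ι → ι → ι → ℝ := fun i j k l =>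
    disj i j k l * (Y i j * Y k l * (Y i k * Y j l * (Y i l * Y j k))) with hq5
  set q6 : ι → ι → ι → ι → ℝ :=
    fun i j k l => disj i j k l * (Y i k * Y j l * (Y i k ^ 2 * Y j l ^ 2)) with hq6
  set q7 : ι → ι → ι → ι → ℝ :=
    fun i j k l => disj i j k l * (Y i l * Y j k * (Y i k ^ 2 * Y j l ^ 2)) with hq7
  have e : quadSum c (fun i j k l => disj i j k l *
        highPart (Y i j) (Y i k) (Y i l) (Y j k) (Y j l) (Y k l)) =
      8 / 3 * quadSum c q1 + 8 * quadSum c q2 - 32 * quadSum c q3 + 8 * quadSum c q4 +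
        16 * quadSum c q5 + 8 / 9 * quadSum c q6 + 8 * quadSum c q7 := by
    have sl := fun e => quadSum_swap_left hcs e
    have sr := fun e => quadSum_swap_right hcs e
    have sb : ∀ e, quadSum c (fun i j k l => e j i l k) = quadSum c e := fun e =>
      (sl fun i j k l => e i j l k).trans (sr e)
    have sp := fun e => quadSum_swap_pairs c e
    have h1 : quadSum c (fun i j k l => disj i j k l *
        highPart (Y i j) (Y i k) (Y i l) (Y j k) (Y j l) (Y k l)) =
        quadSum c (fun i j k l =>
          2 / 3 * (q1 i j k l + q1 j i k l + q1 i j l k + q1 j i l k)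
          + 2 * (q2 i j k l + q2 j i k l + q2 i j l k + q2 j i l k)
          - 4 * (q3 i j k l + q3 j i k l + q3 i j l k + q3 j i l k
            + (q3 k l i j + q3 k l j i + q3 l k i j + q3 l k j i))
          + 4 * (q4 i j k l + q4 j i k l) + 16 * q5 i j k l + 4 / 9 * (q6 i j k l + q6 j i k l)
          + 4 * (q7 i j k l + q7 j i k l)) := by
      refine quadSum_congr hc0 fun i j k l _ _ => ?_
      have d1 := disj_swap_left i j k l
      have d2 := disj_swap_right i j k l
      have d3 : disj j i l k = disj i j k l := by rw [disj_swap_left, d2]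
      have d4 := disj_swap_pairs i j k l
      have d5 : disj k l j i = disj i j k l := by rw [disj_swap_pairs, d1]
      have d6 : disj l k i j = disj i j k l := by rw [disj_swap_pairs, d2]
      have d7 : disj l k j i = disj i j k l := by rw [disj_swap_pairs, d3]
      simp only [hq1, hq2, hq3, hq4, hq5, hq6, hq7, d1, d2, d3, d4, d5, d6, d7, highPart,
        h.symm j i, h.symm k i, h.symm l i, h.symm k j, h.symm l j, h.symm l k]
      ring
    rw [h1]
    simp only [quadSum_add, quadSum_sub, quadSum_mul]
    rw [sl q1, sr q1, sb q1, sl q2, sr q2, sb q2, sl q3, sr q3, sb q3, sp q3, sl q4, sl q6, sl q7]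
    have p1 : quadSum c (fun i j k l => q3 k l j i) = quadSum c q3 :=
      (sl fun i j k l => q3 k l i j).trans (sp q3)
    have p2 : quadSum c (fun i j k l => q3 l k i j) = quadSum c q3 :=
      (sr fun i j k l => q3 k l i j).trans (sp q3)
    have p3 : quadSum c (fun i j k l => q3 l k j i) = quadSum c q3 :=
      (sb fun i j k l => q3 k l i j).trans (sp q3)
    rw [p1, p2, p3]
    ring
  have b1 := abs_le.1 (h.disj_cube_term hc0 (c := c))
  have b2 := abs_le.1 (h.disj_path_term hc0 (c := c))
  have b3 := abs_le.1 (h.disj_fork_term (c := c))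
  have b4 := abs_le.1 (h.disj_square_term (c := c) (a := fun i j k l => Y i j * Y k l)
    fun i j k l => h.abs_mul_le i j k l)
  have b5 := abs_le.1 (h.disj_cycle_term (c := c))
  have b6 := abs_le.1 (h.disj_square_term (c := c) (a := fun i j k l => Y i k * Y j l)
    fun i j k l => h.abs_mul_le i k j l)
  have b7 := abs_le.1 (h.disj_square_term (c := c) (a := fun i j k l => Y i l * Y j k)
    fun i j k l => h.abs_mul_le i l j k)
  have hpos : 0 ≤ δ * r ^ 2 * ∑ i, ∑ j, c i j ^ 2 :=
    mul_nonneg (mul_nonneg h.nonneg (sq_nonneg r)) (by positivity)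
  -- The kernels `q3` to `q7` have total weight `32 + 8 + 16 + 8/9 + 8 ≤ 65`.
  rw [e, abs_le]
  constructor <;> linarith [b1.1, b1.2, b2.1, b2.2, b3.1, b3.2, b4.1, b4.2, b5.1, b5.2, b6.1, b6.2,
    b7.1, b7.2]

/-- Correction for pairs with one common index. -/
lemma OffDiagBound.common_term (h : OffDiagBound Y δ r s) :
    |quadSum c (fun i j k l => if i = k then if j = l then 0 else
        pairMoment (Y j l) - lowPart (Y i j) 1 (Y i l) (Y i j) (Y j l) (Y i l) else 0)| ≤
      13 * (δ * r * ∑ i, ∑ j, c i j ^ 2) := by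
  set w : ι → ι → ι → ι → ℝ := fun i j k l => if i = k then if j = l then 0 else
        pairMoment (Y j l) - lowPart (Y i j) 1 (Y i l) (Y i j) (Y j l) (Y i l) else 0 with hw
  set u : ι → ι → ι → ι → ℝ := fun i j k l => if i = k then δ * (|Y j l| * |Y j l|) else 0 with hu
  set u' : ι → ι → ι → ι → ℝ :=
    fun i j k l => if i = k then δ * (|Y i l| * |Y i j|) else 0 with hu'
  -- The pointwise bound is a sum of two kernels that factor differently for the Schur test. Passing
  -- to `|c|` allows them to be treated separately.
  have h1 : |quadSum (fun i j => |c i j|) u| ≤ δ * r * ∑ i, ∑ j, |c i j| ^ 2 := by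
    refine abs_quadSum_le (f := fun i j k l => if i = k then |Y j l| else 0)
      (g := fun i j k l => if i = k then |Y j l| else 0) h.nonneg ?_ ?_ ?_
    · intro i j k l
      simp only [hu]
      split_ifs
      · rw [abs_of_nonneg (mul_nonneg h.nonneg (by positivity))]
      · simp
    · intro i j
      rw [Finset.sum_comm]
      simpa [ite_pow] using h.row j
    · intro k l
      rw [Finset.sum_comm]
      simpa [ite_pow] using h.col l
  have h2 : |quadSum (fun i j => |c i j|) u'| ≤ δ * r * ∑ i, ∑ j, |c i j| ^ 2 := by
    refine abs_quadSum_le (f := fun i j k l => if i = k then |Y i l| else 0)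
      (g := fun i j k l => if i = k then |Y i j| else 0) h.nonneg ?_ ?_ ?_
    · intro i j k l
      simp only [hu']
      split_ifs
      · rw [abs_of_nonneg (mul_nonneg h.nonneg (by positivity))]
      · simp
    · intro i j
      rw [Finset.sum_comm]
      simpa [ite_pow] using h.row i
    · intro k l
      rw [Finset.sum_comm]
      simpa [ite_pow] using h.row k
  have h3 : |quadSum c w| ≤
      quadSum (fun i j => |c i j|) u + 12 * quadSum (fun i j => |c i j|) u' := by
    rw [← quadSum_mul, ← quadSum_add]
    refine (Finset.abs_sum_le_sum_abs _ _).trans (Finset.sum_le_sum fun i _ => ?_)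
    refine (Finset.abs_sum_le_sum_abs _ _).trans (Finset.sum_le_sum fun j _ => ?_)
    refine (Finset.abs_sum_le_sum_abs _ _).trans (Finset.sum_le_sum fun k _ => ?_)
    refine (Finset.abs_sum_le_sum_abs _ _).trans (Finset.sum_le_sum fun l _ => ?_)
    rw [abs_mul, abs_mul]
    refine mul_le_mul_of_nonneg_left ?_ (by positivity)
    simp only [hw, hu, hu']
    have := h.nonneg
    split_ifs
    · rw [abs_zero]; positivity
    · exact abs_pairMoment_sub_lowPart_le h.le_one (h.entry i j) (h.entry i l) (h.entry j l)
    · simp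
  simp only [sq_abs] at h1 h2
  linarith [le_of_abs_le h1, le_of_abs_le h2]

/-- Correction on the diagonal. -/
lemma OffDiagBound.diag_term (h : OffDiagBound Y δ r s) :
    |quadSum c (fun i j k l => if i = k then if j = l then
        1 - lowPart (Y i j) 1 (Y i j) (Y i j) 1 (Y i j) else 0 else 0)| ≤
      10 * δ * 1 * ∑ i, ∑ j, c i j ^ 2 := by
  have := h.nonneg
  refine abs_quadSum_le (f := fun i j k l => if i = k then if j = l then 1 else 0 else 0)
    (g := fun i j k l => if i = k then if j = l then 1 else 0 else 0) (by positivity) ?_ ?_ ?_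
  · intro i j k l
    split_ifs
    · simpa using abs_one_sub_lowPart_le h.le_one (h.entry i j)
    · simp
    · simp
  · intro i j
    simp [ite_pow]
  · intro k l
    simp [ite_pow]

end bounds

/-! ### Lower bound for the quadratic form on pairs -/

section lower

variable {ι : Type*} [Fintype ι]

/-- The low Wick degrees form a Gram matrix. -/
lemma sq_sum_le_quadSum_lowPart {M X : Matrix ι ι ℝ} (hM : M * M.transpose = X) (c : ι → ι → ℝ) :
    (∑ i, ∑ j, c i j * pairMoment (X i j)) ^ 2 ≤
      quadSum c (fun i j k l => lowPart (X i j) (X i k) (X i l) (X j k) (X j l) (X k l)) := by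
  have hX : ∀ i k, ∑ p, M i p * M k p = X i k := fun i k => by
    rw [← hM, Matrix.mul_apply]; rfl
  -- With `gᵢ = ∑ M i p ξ_p`, this is twice the symmetric kernel of the degree-2 Wick component of
  -- `qᵢ qⱼ`. The doubling accounts for the factor `2` in `hgram`.
  set Φ : ι → ι → ι → ι → ℝ := fun i j p q =>
    (1 + 2 * X i j ^ 2) * (M i p * M j q + M j p * M i q)
      - 2 * X i j * (M i p * M i q + M j p * M j q) with hΦ
  have hT : ∀ i j k l, ∑ p, ∑ q, M i p * M j q * (M k p * M l q) = X i k * X j l := by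
    intro i j k l
    rw [← hX i k, ← hX j l, Finset.sum_mul_sum]
    exact Finset.sum_congr rfl fun p _ => Finset.sum_congr rfl fun q _ => by ring
  have hgram : ∀ i j k l, ∑ p, ∑ q, Φ i j p q * Φ k l p q =
      2 * (lowPart (X i j) (X i k) (X i l) (X j k) (X j l) (X k l)
        - pairMoment (X i j) * pairMoment (X k l)) := by
    intro i j k l
    have e : ∀ p q, Φ i j p q * Φ k l p q =
        (1 + 2 * X i j ^ 2) * (1 + 2 * X k l ^ 2) *
          (M i p * M j q * (M k p * M l q) + M i p * M j q * (M l p * M k q)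
            + M j p * M i q * (M k p * M l q) + M j p * M i q * (M l p * M k q))
        - (1 + 2 * X i j ^ 2) * (2 * X k l) *
          (M i p * M j q * (M k p * M k q) + M i p * M j q * (M l p * M l q)
            + M j p * M i q * (M k p * M k q) + M j p * M i q * (M l p * M l q))
        - 2 * X i j * (1 + 2 * X k l ^ 2) *
          (M i p * M i q * (M k p * M l q) + M i p * M i q * (M l p * M k q)
            + M j p * M j q * (M k p * M l q) + M j p * M j q * (M l p * M k q))
        + 2 * X i j * (2 * X k l) *
          (M i p * M i q * (M k p * M k q) + M i p * M i q * (M l p * M l q)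
            + M j p * M j q * (M k p * M k q) + M j p * M j q * (M l p * M l q)) := by
      intro p q
      simp only [hΦ]
      ring
    simp only [e, Finset.sum_add_distrib, Finset.sum_sub_distrib, ← Finset.mul_sum, hT]
    simp only [lowPart]
    ring
  have hsq : 0 ≤ ∑ p, ∑ q, (∑ i, ∑ j, c i j * Φ i j p q) ^ 2 := by positivity
  have hexp : ∑ p, ∑ q, (∑ i, ∑ j, c i j * Φ i j p q) ^ 2 =
      quadSum c (fun i j k l => ∑ p, ∑ q, Φ i j p q * Φ k l p q) := by
    have e1 : ∀ p q, (∑ i, ∑ j, c i j * Φ i j p q) ^ 2 =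
        quadSum c (fun i j k l => Φ i j p q * Φ k l p q) := by
      intro p q
      simp only [quadSum, sq, Finset.sum_mul, Finset.mul_sum]
      refine Finset.sum_congr rfl fun i _ => Finset.sum_congr rfl fun j _ =>
        Finset.sum_congr rfl fun k _ => Finset.sum_congr rfl fun l _ => by ring
    simp only [e1]
    simp only [quadSum, Finset.mul_sum]
    calc _ = ∑ p, ∑ i, ∑ j, ∑ k, ∑ l, ∑ q, c i j * c k l * (Φ i j p q * Φ k l p q) := by
          refine Finset.sum_congr rfl fun p _ => ?_
          rw [Finset.sum_comm]; refine Finset.sum_congr rfl fun i _ => ?_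
          rw [Finset.sum_comm]; refine Finset.sum_congr rfl fun j _ => ?_
          rw [Finset.sum_comm]; refine Finset.sum_congr rfl fun k _ => ?_
          rw [Finset.sum_comm]
      _ = _ := by
          rw [Finset.sum_comm]; refine Finset.sum_congr rfl fun i _ => ?_
          rw [Finset.sum_comm]; refine Finset.sum_congr rfl fun j _ => ?_
          rw [Finset.sum_comm]; refine Finset.sum_congr rfl fun k _ => ?_
          rw [Finset.sum_comm]
  have hpair : (∑ i, ∑ j, c i j * pairMoment (X i j)) ^ 2 =
      quadSum c (fun i j k l => pairMoment (X i j) * pairMoment (X k l)) := by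
    simp only [quadSum, sq, Finset.sum_mul, Finset.mul_sum]
    refine Finset.sum_congr rfl fun i _ => Finset.sum_congr rfl fun j _ =>
      Finset.sum_congr rfl fun k _ => Finset.sum_congr rfl fun l _ => by ring
  rw [hexp] at hsq
  simp only [hgram] at hsq
  rw [quadSum_mul, quadSum_sub, ← hpair] at hsq
  linarith

variable [DecidableEq ι]

/-- Lower bound for the quadratic form given by the limiting moments on pairs. -/
lemma quadSum_moment_ge {M X : Matrix ι ι ℝ} (hM : M * M.transpose = X) (hX : ∀ i, X i i = 1)
    {δ r s : ℝ} (h : OffDiagBound (fun i j => if i = j then 0 else X i j) δ r s)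
    {c : ι → ι → ℝ} (hc0 : ∀ i, c i i = 0) (hcs : ∀ i j, c i j = c j i)
    {μ : ι → ι → ι → ι → ℝ} (hμl : ∀ i j k l, μ j i k l = μ i j k l)
    (hμr : ∀ i j k l, μ i j l k = μ i j k l)
    (hμ4 : ∀ i j k l, i ≠ j → i ≠ k → i ≠ l → j ≠ k → j ≠ l → k ≠ l →
      μ i j k l = quartMoment (X i j) (X i k) (X i l) (X j k) (X j l) (X k l))
    (hμ2 : ∀ i j l, i ≠ j → i ≠ l → j ≠ l → μ i j i l = pairMoment (X j l))
    (hμ0 : ∀ i j, i ≠ j → μ i j i j = 1) :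
    (∑ i, ∑ j, c i j * pairMoment (X i j)) ^ 2 -
      δ * (8 / 3 * (r * (1 + s) / 2 + 2 * r) + 8 * (s + r) + 65 * r ^ 2 + 52 * r + 20) *
        ∑ i, ∑ j, c i j ^ 2 ≤ quadSum c μ := by
  have hsym : ∀ i k, X i k = X k i := fun i k => by
    rw [← hM, Matrix.mul_apply, Matrix.mul_apply]
    exact Finset.sum_congr rfl fun p _ => mul_comm _ _
  set Y : ι → ι → ℝ := fun i j => if i = j then 0 else X i j with hY
  have hYX : ∀ i j, i ≠ j → Y i j = X i j := fun i j hij => if_neg hij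
  set w : ι → ι → ι → ι → ℝ := fun i j k l => if i = k then if j = l then 0 else
        pairMoment (Y j l) - lowPart (Y i j) 1 (Y i l) (Y i j) (Y j l) (Y i l) else 0 with hw
  set d : ι → ι → ι → ι → ℝ := fun i j k l => if i = k then if j = l then
        1 - lowPart (Y i j) 1 (Y i j) (Y i j) 1 (Y i j) else 0 else 0 with hd
  set L : ι → ι → ι → ι → ℝ :=
    fun i j k l => lowPart (X i j) (X i k) (X i l) (X j k) (X j l) (X k l) with hL
  set H : ι → ι → ι → ι → ℝ := fun i j k l => disj i j k l *
        highPart (Y i j) (Y i k) (Y i l) (Y j k) (Y j l) (Y k l) with hH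
  have hLl : ∀ i j k l, L j i k l = L i j k l := fun i j k l => by
    simp only [hL, lowPart, hsym j i]; ring
  have hLr : ∀ i j k l, L i j l k = L i j k l := fun i j k l => by
    simp only [hL, lowPart, hsym l k]; ring
  have hone : ∀ i j l, i ≠ j → i ≠ l → j ≠ l → μ i j i l = L i j i l + w i j i l := by
    intro i j l hij hil hjl
    rw [hμ2 i j l hij hil hjl]
    simp only [hL, hw, if_true, if_neg hjl, hYX i j hij, hYX i l hil, hYX j l hjl, hX, hsym j i]
    ring
  have htwo : ∀ i j, i ≠ j → μ i j i j = L i j i j + d i j i j := by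
    intro i j hij
    rw [hμ0 i j hij]
    simp only [hL, hd, if_true, hYX i j hij, hX, hsym j i]
    ring
  -- The low part is kept everywhere, with `X i i = 1` at coincidences. The four copies of `w`
  -- correct the four ways of sharing exactly one index, the two copies of `d` the two ways in which
  -- the pairs coincide.
  have key : quadSum c μ = quadSum c (fun i j k l => L i j k l + H i j k l +
      (w i j k l + w j i k l + w i j l k + w j i l k) + (d i j k l + d i j l k)) := by
    refine quadSum_congr hc0 fun i j k l hij hkl => ?_
    by_cases hik : i = k
    · subst hik
      by_cases hjl : j = l
      · subst hjl
        rw [htwo i j hij]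
        simp [hw, hd, hH, disj, hij, hij.symm]
      · rw [hone i j l hij hkl hjl]
        simp [hw, hd, hH, disj, hij.symm, hjl, hkl]
    by_cases hil : i = l
    · subst hil
      rw [← hμr, ← hLr]
      by_cases hjk : j = k
      · subst hjk
        rw [htwo i j hij]
        simp [hw, hd, hH, disj, hij, hij.symm]
      · rw [hone i j k hij hik hjk]
        simp [hw, hd, hH, disj, hij.symm, hjk, hik]
    by_cases hjk : j = k
    · subst hjk
      rw [← hμl, ← hLl, hone j i l (Ne.symm hij) hkl hil]
      simp [hw, hd, hH, disj, hij, hil, hkl]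
    by_cases hjl : j = l
    · subst hjl
      rw [← hμl, ← hμr, ← hLl, ← hLr, hone j i k (Ne.symm hij) hjk hik]
      simp [hw, hd, hH, disj, hij, hik, hjk]
    rw [hμ4 i j k l hij hik hil hjk hjl hkl, quartMoment_eq]
    simp [hw, hd, hH, hL, disj, hik, hil, hjk, hjl, hYX _ _ hij, hYX _ _ hik, hYX _ _ hil,
      hYX _ _ hjk, hYX _ _ hjl, hYX _ _ hkl]
  rw [key]
  simp only [quadSum_add]
  have sl := quadSum_swap_left hcs w
  have sr := quadSum_swap_right hcs w
  have sb : quadSum c (fun i j k l => w j i l k) = quadSum c w :=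
    (quadSum_swap_left hcs fun i j k l => w i j l k).trans sr
  rw [sl, sr, sb, quadSum_swap_right hcs d]
  have b1 := neg_le_of_abs_le (h.disj_highPart hc0 hcs)
  -- Four corrections with constant `13` and two with constant `10` give `52 * r + 20`.
  have b2 := neg_le_of_abs_le (h.common_term (c := c))
  have b3 := neg_le_of_abs_le (h.diag_term (c := c))
  have b4 := sq_sum_le_quadSum_lowPart hM c
  linarith

end lower

/-! ### The limiting moments -/

/-- The universal polynomials giving the limiting moments of `k ≤ 4` seed polynomials. -/
noncomputable def momentPoly : (k : ℕ) → MvPolynomial (Fin k × Fin k) ℚ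
  | 0 => 1
  | 2 => MvPolynomial.X (0, 1) + MvPolynomial.C (2 / 3) * MvPolynomial.X (0, 1) ^ 3
  | 4 => quartMoment (MvPolynomial.X (0, 1)) (MvPolynomial.X (0, 2)) (MvPolynomial.X (0, 3))
      (MvPolynomial.X (1, 2)) (MvPolynomial.X (1, 3)) (MvPolynomial.X (2, 3))
  -- Odd moments vanish by symmetry; `k > 4` cannot occur for a symmetric difference of two indices.
  | _ => 0

section moments

variable {n : ℕ} {X : Matrix (Fin n) (Fin n) ℝ}

lemma tendsto_seedMoment {M : Matrix (Fin n) (Fin n) ℝ} (hM : M * M.transpose = X)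
    (hX : ∀ i, X i i = 1) {k : ℕ} (hk : k ≤ 4) (e : Fin k ↪ Fin n) :
    Filter.Tendsto (seedMoment M (Finset.univ.map e)) Filter.atTop
      (nhds (MvPolynomial.aeval (fun p : Fin k × Fin k => X (e p.1) (e p.2)) (momentPoly k))) := by
  have hodd : Odd k → Filter.Tendsto (seedMoment M (Finset.univ.map e)) Filter.atTop (nhds 0) := by
    intro ho
    have : seedMoment M (Finset.univ.map e) = fun _ => 0 :=
      funext fun m => seedMoment_eq_zero_of_odd M (by simpa using ho) m
    rw [this]
    exact tendsto_const_nhds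
  interval_cases k
  · have : seedMoment M (Finset.univ.map e) = fun _ => 1 := by
      funext m
      simp [seedMoment]
    rw [this]
    simp [momentPoly]
  · simpa [momentPoly] using hodd (by decide)
  · simpa [momentPoly, pairMoment] using tendsto_seedMoment_pair hM hX e
  · simpa [momentPoly] using hodd (by decide)
  · simpa [momentPoly, map_quartMoment] using tendsto_seedMoment_quart hM hX e

open scoped MatrixOrder in
lemma exists_mul_transpose_eq (hX : X.PosSemidef) :
    ∃ M : Matrix (Fin n) (Fin n) ℝ, M * M.transpose = X := by
  refine ⟨CFC.sqrt X, ?_⟩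
  have h : (CFC.sqrt X).transpose = CFC.sqrt X := (CFC.sqrt_nonneg X).isSelfAdjoint
  rw [h]
  exact CFC.sqrt_mul_sqrt_self X hX.nonneg

lemma factor_mul_transpose (hX : X.PosSemidef) : factor X * (factor X).transpose = X := by
  have h := exists_mul_transpose_eq hX
  rw [factor, dif_pos h]
  exact h.choose_spec

lemma card_symmDiff_le (S T : Idx n) : (S.1 ∆ T.1).card ≤ 4 := by
  have h : S.1 ∆ T.1 ⊆ S.1 ∪ T.1 := symmDiff_le_sup
  have := (Finset.card_le_card h).trans (Finset.card_union_le _ _)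
  have := S.2
  have := T.2
  omega

lemma momentMatrix_eq (hX : X ∈ SoS2 n) {S T : Idx n} {k : ℕ} {e : Fin k ↪ Fin n}
    (he : Finset.univ.map e = S.1 ∆ T.1) :
    momentMatrix X S T =
      MvPolynomial.aeval (fun p : Fin k × Fin k => X (e p.1) (e p.2)) (momentPoly k) := by
  have hk : k ≤ 4 := by
    have := card_symmDiff_le S T
    rw [← he] at this
    simpa using this
  have := (tendsto_seedMoment (factor_mul_transpose hX.1) hX.2 hk e).limUnder_eq
  rw [he] at this
  exact this

lemma tendsto_momentMatrix (hX : X ∈ SoS2 n) {M : Matrix (Fin n) (Fin n) ℝ}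
    (hM : M * M.transpose = X) (S T : Idx n) :
    Filter.Tendsto (seedMoment M (S.1 ∆ T.1)) Filter.atTop (nhds (momentMatrix X S T)) := by
  have he := Finset.map_orderEmbOfFin_univ (S.1 ∆ T.1) rfl
  rw [momentMatrix_eq hX he]
  have := tendsto_seedMoment hM hX.2 (card_symmDiff_le S T)
    ((S.1 ∆ T.1).orderEmbOfFin rfl).toEmbedding
  rwa [he] at this

lemma momentMatrix_self (hX : X ∈ SoS2 n) (S : Idx n) : momentMatrix X S S = 1 := by
  rw [momentMatrix_eq hX (e := (⟨Fin.elim0, fun a => a.elim0⟩ : Fin 0 ↪ Fin n)) (by simp)]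
  simp [momentPoly]

lemma momentMatrix_pair (hX : X ∈ SoS2 n) {S T : Idx n} {i j : Fin n} (hij : i ≠ j)
    (h : S.1 ∆ T.1 = {i, j}) : momentMatrix X S T = pairMoment (X i j) := by
  have hinj : Function.Injective ![i, j] := by
    intro a b
    fin_cases a <;> fin_cases b <;> simp [hij, hij.symm]
  rw [momentMatrix_eq hX (e := ⟨![i, j], hinj⟩) (by rw [h]; ext; simp [Fin.exists_fin_two, eq_comm])]
  simp [momentPoly, pairMoment]

lemma momentMatrix_quart (hX : X ∈ SoS2 n) {S T : Idx n} {i j k l : Fin n} (hij : i ≠ j)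
    (hik : i ≠ k) (hil : i ≠ l) (hjk : j ≠ k) (hjl : j ≠ l) (hkl : k ≠ l)
    (h : S.1 ∆ T.1 = {i, j, k, l}) :
    momentMatrix X S T = quartMoment (X i j) (X i k) (X i l) (X j k) (X j l) (X k l) := by
  have hinj : Function.Injective ![i, j, k, l] := by
    intro a b
    fin_cases a <;> fin_cases b <;>
      simp [hij, hij.symm, hik, hik.symm, hil, hil.symm, hjk, hjk.symm, hjl, hjl.symm, hkl,
        hkl.symm]
  rw [momentMatrix_eq hX (e := ⟨![i, j, k, l], hinj⟩) (by
    rw [h]; ext; simp [Fin.exists_fin_succ, eq_comm])]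
  simp [momentPoly, map_quartMoment]

lemma momentMatrix_odd (hX : X ∈ SoS2 n) {S T : Idx n} (h : Odd (S.1 ∆ T.1).card) :
    momentMatrix X S T = 0 := by
  refine tendsto_nhds_unique (tendsto_momentMatrix hX (factor_mul_transpose hX.1) S T) ?_
  rw [funext (seedMoment_eq_zero_of_odd (factor X) h)]
  exact tendsto_const_nhds

/-! ### Sums over the subsets of size at most two -/

/-- The set `{i, j}` as an index. -/
def pairIdx (i j : Fin n) : Idx n := ⟨{i, j}, Finset.card_le_two⟩

lemma pairIdx_comm (i j : Fin n) : pairIdx i j = pairIdx j i :=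
  Subtype.ext (Finset.pair_comm i j)

/-- Sums over ordered pairs match `quadSum`; each two-element set is then counted twice, hence the
`1 / 2`, and `1 / 4` in the quadratic form. -/
lemma sum_idx (f : Idx n → ℝ) :
    ∑ S, f S = f (emptyIdx n) + ∑ i, f (single i) +
      1 / 2 * ∑ i, ∑ j, if i = j then 0 else f (pairIdx i j) := by
  have hpt : ∀ S : Idx n, f S = (if emptyIdx n = S then f S else 0) +
      ∑ i, (if single i = S then f S else 0) +
      1 / 2 * ∑ i, ∑ j, (if i = j then 0 else if pairIdx i j = S then f S else 0) := by
    rintro ⟨S, hS⟩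
    generalize f ⟨S, hS⟩ = a
    simp only [single, pairIdx, Subtype.mk.injEq]
    have h3 : S.card = 0 ∨ S.card = 1 ∨ S.card = 2 := by omega
    rcases h3 with h | h | h
    · rw [Finset.card_eq_zero] at h
      subst h
      rw [if_pos (show emptyIdx n = ⟨∅, hS⟩ from rfl)]
      simp
    · obtain ⟨x, rfl⟩ := Finset.card_eq_one.1 h
      have : ∀ i j, (if i = j then (0 : ℝ) else if ({i, j} : Finset (Fin n)) = {x} then a else 0)
          = 0 := by
        intro i j
        split_ifs with h1 h2
        · rfl
        · have := Finset.card_pair h1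
          rw [h2] at this
          simp at this
        · rfl
      have h0 : emptyIdx n ≠ ⟨{x}, hS⟩ := fun h =>
        Finset.singleton_ne_empty x (congrArg Subtype.val h).symm
      simp [this, h0]
    · have h1 : ∀ i : Fin n, ({i} : Finset (Fin n)) ≠ S := by
        rintro i rfl
        simp at h
      have h0 : emptyIdx n ≠ ⟨S, hS⟩ := by
        intro h'
        have : ∅ = S := congrArg Subtype.val h'
        subst this
        simp at h
      have h2 : ∀ i j, (if i = j then (0 : ℝ) else if ({i, j} : Finset (Fin n)) = S then a else 0) =
          if (i, j) ∈ S.offDiag then a else 0 := by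
        intro i j
        simp only [Finset.mem_offDiag]
        by_cases hij : i = j
        · simp [hij]
        · have : ({i, j} : Finset (Fin n)) = S ↔ i ∈ S ∧ j ∈ S := by
            constructor
            · rintro rfl
              simp
            · rintro ⟨hi, hj⟩
              refine Finset.eq_of_subset_of_card_le ?_ (by rw [h, Finset.card_pair hij])
              intro x hx
              simp only [Finset.mem_insert, Finset.mem_singleton] at hx
              rcases hx with rfl | rfl <;> assumption
          simp [hij, this]
      simp only [h0, h1, h2, if_false, Finset.sum_const_zero, zero_add]
      rw [← Finset.sum_product' (s := Finset.univ) (t := Finset.univ)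
        (f := fun i j => if (i, j) ∈ S.offDiag then a else 0)]
      simp only [Prod.mk.eta, Finset.univ_product_univ, Finset.sum_ite_mem, Finset.univ_inter,
        Finset.sum_const, Finset.offDiag_card, h]
      norm_num
      ring
  calc ∑ S, f S = _ := Finset.sum_congr rfl fun S _ => hpt S
    _ = _ := by
      rw [Finset.sum_add_distrib, Finset.sum_add_distrib, ← Finset.mul_sum, Finset.sum_comm]
      congr 1
      · simp
      · rw [Finset.sum_comm]
        congr 1
        refine Finset.sum_congr rfl fun i _ => ?_
        rw [Finset.sum_comm]
        refine Finset.sum_congr rfl fun j _ => ?_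
        split_ifs <;> simp

end moments

/-! ### Norm bounds -/

section norms

variable {n : ℕ} {X : Matrix (Fin n) (Fin n) ℝ}

lemma alphaMag_nonneg (X : Matrix (Fin n) (Fin n) ℝ) : 0 ≤ alphaMag X :=
  Real.iSup_nonneg fun _ => abs_nonneg _

lemma alphaRow_nonneg (X : Matrix (Fin n) (Fin n) ℝ) : 0 ≤ alphaRow X :=
  Real.iSup_nonneg fun _ => Real.sqrt_nonneg _

lemma alpha_nonneg {C : ℝ} (hC : 0 ≤ C) (X : Matrix (Fin n) (Fin n) ℝ) : 0 ≤ alpha C X := by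
  have := alphaMag_nonneg X
  unfold alpha
  positivity

lemma abs_apply_le_alphaMag (X : Matrix (Fin n) (Fin n) ℝ) {i j : Fin n} (h : i ≠ j) :
    |X i j| ≤ alphaMag X :=
  le_ciSup (f := fun p : {p : Fin n × Fin n // p.1 ≠ p.2} => |X p.1.1 p.1.2|)
    (Set.finite_range _).bddAbove ⟨(i, j), h⟩

lemma sum_sq_le_alphaRow (X : Matrix (Fin n) (Fin n) ℝ) (i : Fin n) :
    ∑ j ∈ Finset.univ.erase i, X i j ^ 2 ≤ alphaRow X ^ 2 := by
  rw [← Real.sqrt_le_left (alphaRow_nonneg X)]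
  exact le_ciSup (f := fun i : Fin n => √(∑ j ∈ Finset.univ.erase i, X i j ^ 2))
    (Set.finite_range _).bddAbove i

lemma sum_mulVec_sq_le (X : Matrix (Fin n) (Fin n) ℝ) (v : Fin n → ℝ) :
    ∑ i, (∑ j, X i j * v j) ^ 2 ≤ alphaSpec X ^ 2 * ∑ j, v j ^ 2 := by
  have h := (Matrix.toEuclideanCLM (𝕜 := ℝ) X).le_opNorm (WithLp.toLp 2 v)
  rw [Matrix.toEuclideanCLM_toLp] at h
  have h2 := pow_le_pow_left₀ (norm_nonneg _) h 2
  rw [mul_pow, EuclideanSpace.norm_sq_eq, EuclideanSpace.norm_sq_eq] at h2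
  simpa [Matrix.mulVec, dotProduct, alphaSpec] using h2

lemma offDiagBound (hX : X ∈ SoS2 n) :
    OffDiagBound (fun i j => if i = j then 0 else X i j) (alphaMag X) (alphaRow X ^ 2)
      (2 * (1 + alphaSpec X ^ 2)) := by
  obtain ⟨M, hM⟩ := exists_mul_transpose_eq hX.1
  have hMX : ∀ i k, ∑ p, M i p * M k p = X i k := fun i k => by
    rw [← hM, Matrix.mul_apply]; rfl
  refine ⟨fun i => if_pos rfl, fun i j => ?_, ?_, alphaMag_nonneg X, fun i j => ?_, sq_nonneg _,
    fun i => ?_, fun v => ?_⟩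
  · by_cases h : i = j
    · simp [h]
    · rw [if_neg h, if_neg (Ne.symm h), ← hMX, ← hMX]
      exact Finset.sum_congr rfl fun p _ => mul_comm _ _
  -- Cauchy–Schwarz for the rows of `M`, which are unit vectors.
  · refine Real.iSup_le (fun p => ?_) zero_le_one
    have h := Finset.sum_mul_sq_le_sq_mul_sq Finset.univ (M p.1.1) (M p.1.2)
    simp only [sq (M _ _)] at h
    rw [hMX, hMX, hMX, hX.2, hX.2] at h
    exact (sq_le_one_iff_abs_le_one _).1 (by linarith)
  · split_ifs with h
    · simpa using alphaMag_nonneg X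
    · exact abs_apply_le_alphaMag X h
  · refine le_trans (le_of_eq ?_) (sum_sq_le_alphaRow X i)
    rw [← Finset.sum_erase_add _ _ (Finset.mem_univ i)]
    simp only [if_true]
    rw [zero_pow two_ne_zero, add_zero]
    refine Finset.sum_congr rfl fun j hj => ?_
    rw [if_neg (Finset.ne_of_mem_erase hj).symm]
  · have e : ∀ i, ∑ j, (if i = j then 0 else X i j) * v j = ∑ j, X i j * v j - v i := by
      intro i
      rw [eq_sub_iff_add_eq, ← Finset.sum_erase_add _ _ (Finset.mem_univ i),
        ← Finset.sum_erase_add (a := i) _ _ (Finset.mem_univ i)]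
      simp only [if_true, zero_mul, add_zero, hX.2, one_mul]
      congr 1
      refine Finset.sum_congr rfl fun j hj => ?_
      rw [if_neg (Finset.ne_of_mem_erase hj).symm]
    simp only [e]
    -- Deleting the unit diagonal subtracts `v`, so `(x - y)² ≤ 2x² + 2y²` gives the operator bound
    -- `2 * (1 + alphaSpec X ^ 2)`.
    have h := sum_mulVec_sq_le X v
    calc ∑ i, (∑ j, X i j * v j - v i) ^ 2
        ≤ ∑ i, (2 * (∑ j, X i j * v j) ^ 2 + 2 * v i ^ 2) := Finset.sum_le_sum fun i _ => by
          nlinarith [sq_nonneg (∑ j, X i j * v j + v i)]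
      _ ≤ _ := by
          rw [Finset.sum_add_distrib, ← Finset.mul_sum, ← Finset.mul_sum]
          linarith

end norms

/-! ### Positive semidefiniteness of the lift -/

section psd

variable {n : ℕ} {X : Matrix (Fin n) (Fin n) ℝ}

lemma momentMatrix_comm (X : Matrix (Fin n) (Fin n) ℝ) (S T : Idx n) :
    momentMatrix X S T = momentMatrix X T S := by
  simp only [momentMatrix, Matrix.of_apply, symmDiff_comm]

/-- The block of singletons. -/
lemma singleton_form_ge (hX : X ∈ SoS2 n) (t : Fin n → ℝ) :
    -(alphaMag X * alphaRow X ^ 2 * ∑ i, t i ^ 2) ≤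
      ∑ i, ∑ j, t i * t j * momentMatrix X (single i) (single j) := by
  have hb := offDiagBound hX
  set Y : Fin n → Fin n → ℝ := fun i j => if i = j then 0 else X i j with hY
  have hm : ∀ i j, momentMatrix X (single i) (single j) = X i j + 2 / 3 * Y i j ^ 3 := by
    intro i j
    by_cases h : i = j
    · subst h
      rw [momentMatrix_self hX, hX.2, hb.diag]
      norm_num
    · rw [momentMatrix_pair hX h (by simp only [single]; grind [Finset.mem_symmDiff])]
      simp [pairMoment, hY, h]
  have hpsd : 0 ≤ ∑ i, ∑ j, t i * t j * X i j := by
    have := hX.1.dotProduct_mulVec_nonneg t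
    simp only [dotProduct, Matrix.mulVec, Pi.star_apply, star_trivial, Finset.mul_sum] at this
    refine this.trans_eq (Finset.sum_congr rfl fun i _ => Finset.sum_congr rfl fun j _ => by ring)
  -- `X` itself is positive semidefinite; only the off-diagonal cubes can be negative, and `|Y|³ ≤
  -- α_mag Y²` with AM-GM bounds them through row sums of squares.
  have hcube : -(∑ i, ∑ j, (alphaMag X / 2 * (t i ^ 2 * Y i j ^ 2) +
      alphaMag X / 2 * (t j ^ 2 * Y i j ^ 2))) ≤ ∑ i, ∑ j, t i * t j * (2 / 3 * Y i j ^ 3) := by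
    simp only [← Finset.sum_neg_distrib]
    refine Finset.sum_le_sum fun i _ => Finset.sum_le_sum fun j _ => ?_
    have h1 : |t i * t j * (2 / 3 * Y i j ^ 3)| ≤
        (t i ^ 2 + t j ^ 2) / 2 * (alphaMag X * Y i j ^ 2) := by
      rw [abs_mul]
      refine mul_le_mul ?_ ?_ (abs_nonneg _) (by positivity)
      · rw [abs_mul, ← sq_abs (t i), ← sq_abs (t j)]
        linarith [sq_nonneg (|t i| - |t j|)]
      · rw [abs_mul, abs_pow, ← sq_abs (Y i j), abs_of_nonneg (by norm_num : (0 : ℝ) ≤ 2 / 3)]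
        have h2 := mul_le_mul_of_nonneg_right (hb.entry i j) (sq_nonneg |Y i j|)
        nlinarith [pow_nonneg (abs_nonneg (Y i j)) 3]
    linarith [neg_le_of_abs_le h1]
  have hA : ∑ i, ∑ j, t i ^ 2 * Y i j ^ 2 ≤ alphaRow X ^ 2 * ∑ i, t i ^ 2 := by
    rw [Finset.mul_sum]
    refine Finset.sum_le_sum fun i _ => ?_
    rw [← Finset.mul_sum, mul_comm]
    exact mul_le_mul_of_nonneg_right (hb.row i) (sq_nonneg _)
  have hB : ∑ i, ∑ j, t j ^ 2 * Y i j ^ 2 ≤ alphaRow X ^ 2 * ∑ i, t i ^ 2 := by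
    rw [Finset.mul_sum, Finset.sum_comm]
    refine Finset.sum_le_sum fun i _ => ?_
    rw [← Finset.mul_sum, mul_comm]
    exact mul_le_mul_of_nonneg_right (hb.col i) (sq_nonneg _)
  have hAB := mul_le_mul_of_nonneg_left (add_le_add hA hB)
    (show 0 ≤ alphaMag X / 2 by linarith [alphaMag_nonneg X])
  simp only [hm, mul_add, Finset.sum_add_distrib]
  simp only [Finset.sum_add_distrib, ← Finset.mul_sum] at hcube
  simp only [← Finset.mul_sum] at hA hB hAB ⊢
  linarith

/-- The block of the empty set and the pairs. -/
lemma even_form_ge (hX : X ∈ SoS2 n) (v : Idx n → ℝ) {c : Fin n → Fin n → ℝ}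
    (hc : c = fun i j => if i = j then 0 else v (pairIdx i j)) :
    -(1 / 4 * (alphaMag X * (171 * ((1 + alphaRow X ^ 4) * (1 + alphaSpec X ^ 2))) *
        ∑ i, ∑ j, c i j ^ 2)) ≤
      v (emptyIdx n) ^ 2 + v (emptyIdx n) * ∑ i, ∑ j, c i j * pairMoment (X i j) +
        1 / 4 * quadSum c (fun i j k l => momentMatrix X (pairIdx i j) (pairIdx k l)) := by
  obtain ⟨M, hM⟩ := exists_mul_transpose_eq hX.1
  have h := quadSum_moment_ge hM hX.2 (offDiagBound hX) (c := c)
    (μ := fun i j k l => momentMatrix X (pairIdx i j) (pairIdx k l))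
    (fun i => by simp [hc]) (fun i j => by simp only [hc, eq_comm, pairIdx_comm])
    (fun i j k l => by rw [pairIdx_comm i j]) (fun i j k l => by rw [pairIdx_comm k l])
    (fun i j k l hij hik hil hjk hjl hkl => momentMatrix_quart hX hij hik hil hjk hjl hkl (by
      simp only [pairIdx]; grind [Finset.mem_symmDiff]))
    (fun i j l hij hil hjl => momentMatrix_pair hX hjl (by
      simp only [pairIdx]; grind [Finset.mem_symmDiff]))
    (fun i j _ => momentMatrix_self hX _)
  set r := alphaRow X ^ 2 with hr
  have hr4 : alphaRow X ^ 4 = r ^ 2 := by rw [hr]; ring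
  rw [hr4]
  set σ := alphaSpec X ^ 2 with hσ
  have hr0 : 0 ≤ r := sq_nonneg _
  have hσ0 : 0 ≤ σ := sq_nonneg _
  have hr1 : 2 * r ≤ 1 + r ^ 2 := by nlinarith [sq_nonneg (r - 1)]
  -- The value `171` is generous. Terms linear in `r` are absorbed by `2 * r ≤ 1 + r ^ 2`.
  have hconst : 8 / 3 * (r * (1 + 2 * (1 + σ)) / 2 + 2 * r) + 8 * (2 * (1 + σ) + r) + 65 * r ^ 2 +
      52 * r + 20 ≤ 171 * ((1 + r ^ 2) * (1 + σ)) := by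
    nlinarith [mul_nonneg hr0 hσ0, mul_nonneg (sq_nonneg r) hσ0,
      mul_le_mul_of_nonneg_right hr1 hσ0]
  have hS : 0 ≤ ∑ i, ∑ j, c i j ^ 2 := by positivity
  have h2 := mul_le_mul_of_nonneg_right
    (mul_le_mul_of_nonneg_left hconst (alphaMag_nonneg X)) hS
  -- The degree-0 part of the pair form completes the square with the empty-set terms.
  nlinarith [sq_nonneg (v (emptyIdx n) + 1 / 2 * ∑ i, ∑ j, c i j * pairMoment (X i j))]

/-- Parity kills all entries between sets of odd and of even size, so the two blocks are bounded
separately. Pairs enter the norm as `1 / 2 * ∑ c²`, so `100` suffices because `171 / 4 ≤ 100 / 2`;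
singletons need only the constant `1`. -/
lemma momentMatrix_add_posSemidef (hX : X ∈ SoS2 n) :
    (momentMatrix X + alpha 100 X • (1 : Matrix (Idx n) (Idx n) ℝ)).PosSemidef := by
  refine Matrix.PosSemidef.of_dotProduct_mulVec_nonneg ?_ fun v => ?_
  · refine Matrix.IsHermitian.ext fun S T => ?_
    rw [star_trivial, Matrix.add_apply, Matrix.add_apply, momentMatrix_comm]
    simp [Matrix.one_apply, eq_comm]
  have hform : star v ⬝ᵥ ((momentMatrix X + alpha 100 X • (1 : Matrix (Idx n) (Idx n) ℝ)).mulVec v)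
      = ∑ S, ∑ T, v S * v T * momentMatrix X S T + alpha 100 X * ∑ S, v S ^ 2 := by
    rw [Matrix.add_mulVec, dotProduct_add, Matrix.smul_mulVec, Matrix.one_mulVec,
      dotProduct_smul, smul_eq_mul]
    simp only [dotProduct, Matrix.mulVec, Pi.star_apply, star_trivial, Finset.mul_sum]
    congr 1
    · exact Finset.sum_congr rfl fun S _ => Finset.sum_congr rfl fun T _ => by ring
    · exact Finset.sum_congr rfl fun S _ => by ring
  rw [hform]
  set c : Fin n → Fin n → ℝ := fun i j => if i = j then 0 else v (pairIdx i j) with hc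
  set t : Fin n → ℝ := fun i => v (single i) with ht
  have z1 : ∀ i, momentMatrix X (emptyIdx n) (single i) = 0 := fun i =>
    momentMatrix_odd hX (by
      have : (emptyIdx n).1 ∆ (single i).1 = {i} := by
        simp only [emptyIdx, single]; grind [Finset.mem_symmDiff]
      rw [this]; simp)
  have z2 : ∀ i j k, j ≠ k → momentMatrix X (single i) (pairIdx j k) = 0 := fun i j k hjk =>
    momentMatrix_odd hX (by
      simp only [single, pairIdx]
      by_cases h1 : i = j
      · have : ({i} : Finset (Fin n)) ∆ {j, k} = {k} := by grind [Finset.mem_symmDiff]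
        rw [this]; simp
      by_cases h2 : i = k
      · have : ({i} : Finset (Fin n)) ∆ {j, k} = {j} := by grind [Finset.mem_symmDiff]
        rw [this]; simp
      have : ({i} : Finset (Fin n)) ∆ {j, k} = {i, j, k} := by grind [Finset.mem_symmDiff]
      rw [this, Finset.card_eq_three.2 ⟨i, j, k, h1, h2, hjk, rfl⟩]
      decide)
  have z3 : ∀ j k, j ≠ k → momentMatrix X (emptyIdx n) (pairIdx j k) = pairMoment (X j k) :=
    fun j k hjk => momentMatrix_pair hX hjk (by
      simp only [emptyIdx, pairIdx]; grind [Finset.mem_symmDiff])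
  have hE : ∑ T, v (emptyIdx n) * v T * momentMatrix X (emptyIdx n) T =
      v (emptyIdx n) ^ 2 + v (emptyIdx n) * (1 / 2 * ∑ j, ∑ k, c j k * pairMoment (X j k)) := by
    rw [sum_idx, momentMatrix_self hX]
    simp only [z1, mul_zero, Finset.sum_const_zero, Finset.mul_sum, add_zero, mul_one]
    rw [sq]
    congr 1
    refine Finset.sum_congr rfl fun j _ => Finset.sum_congr rfl fun k _ => ?_
    by_cases hjk : j = k
    · simp [hc, hjk]
    · simp only [hc, if_neg hjk, z3 j k hjk]
      ring
  have hT : ∀ i, ∑ T, v (single i) * v T * momentMatrix X (single i) T =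
      ∑ j, t i * t j * momentMatrix X (single i) (single j) := by
    intro i
    rw [sum_idx, momentMatrix_comm, z1]
    have : ∀ j k, (if j = k then 0 else
        v (single i) * v (pairIdx j k) * momentMatrix X (single i) (pairIdx j k)) = 0 := by
      intro j k
      split_ifs with hjk
      · rfl
      · rw [z2 i j k hjk, mul_zero]
    simp only [this, ht]
    simp
  have hP : ∀ i j, (if i = j then 0 else
      ∑ T, v (pairIdx i j) * v T * momentMatrix X (pairIdx i j) T) =
      v (emptyIdx n) * (c i j * pairMoment (X i j)) +
        1 / 2 * ∑ k, ∑ l, c i j * c k l * momentMatrix X (pairIdx i j) (pairIdx k l) := by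
    intro i j
    by_cases hij : i = j
    · simp [hc, hij]
    · have hcij : v (pairIdx i j) = c i j := by simp only [hc, if_neg hij]
      rw [if_neg hij, sum_idx, momentMatrix_comm, z3 i j hij, hcij]
      have h0 : ∀ k, c i j * v (single k) * momentMatrix X (pairIdx i j) (single k) = 0 := by
        intro k
        rw [momentMatrix_comm, z2 k i j hij, mul_zero]
      simp only [h0, Finset.sum_const_zero, add_zero]
      congr 1
      · ring
      · congr 1
        refine Finset.sum_congr rfl fun k _ => Finset.sum_congr rfl fun l _ => ?_
        by_cases hkl : k = l
        · simp [hc, hkl]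
        · simp only [hc, if_neg hkl]
  have hQ : ∑ S, ∑ T, v S * v T * momentMatrix X S T =
      v (emptyIdx n) ^ 2 + v (emptyIdx n) * ∑ i, ∑ j, c i j * pairMoment (X i j) +
        1 / 4 * quadSum c (fun i j k l => momentMatrix X (pairIdx i j) (pairIdx k l)) +
        ∑ i, ∑ j, t i * t j * momentMatrix X (single i) (single j) := by
    rw [sum_idx, hE]
    simp only [hT, hP, Finset.sum_add_distrib, ← Finset.mul_sum]
    rw [quadSum]
    ring
  have hN : ∑ S, v S ^ 2 = v (emptyIdx n) ^ 2 + ∑ i, t i ^ 2 + 1 / 2 * ∑ i, ∑ j, c i j ^ 2 := by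
    rw [sum_idx]
    congr 2
    refine Finset.sum_congr rfl fun i _ => Finset.sum_congr rfl fun j _ => ?_
    simp only [hc]
    split_ifs <;> simp
  have b1 := singleton_form_ge hX t
  have b2 := even_form_ge hX v hc
  rw [hQ, hN]
  have hα := alpha_nonneg (by norm_num : (0 : ℝ) ≤ 100) X
  set Z := (1 + alphaRow X ^ 4) * (1 + alphaSpec X ^ 2) with hZ
  have hαZ : alpha 100 X = 100 * (alphaMag X * Z) := by rw [alpha, hZ]; ring
  have hmag := alphaMag_nonneg X
  have hrow : alphaRow X ^ 2 ≤ Z := by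
    rw [hZ]
    nlinarith [sq_nonneg (alphaRow X ^ 2 - 1), sq_nonneg (alphaRow X ^ 2),
      mul_nonneg (sq_nonneg (alphaRow X ^ 2)) (sq_nonneg (alphaSpec X)), sq_nonneg (alphaSpec X)]
  have hZ0 : 0 ≤ alphaMag X * Z := mul_nonneg hmag ((sq_nonneg _).trans hrow)
  have ht0 : 0 ≤ ∑ i, t i ^ 2 := by positivity
  have hc0 : 0 ≤ ∑ i, ∑ j, c i j ^ 2 := by positivity
  have b3 := mul_le_mul_of_nonneg_right (mul_le_mul_of_nonneg_left hrow hmag) ht0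
  have b4 := mul_nonneg hZ0 ht0
  have b5 := mul_nonneg hZ0 hc0
  have b6 := mul_nonneg hZ0 (sq_nonneg (v (emptyIdx n)))
  rw [hαZ]
  linarith

lemma lift_eq {C : ℝ} (hC : 0 ≤ C) (X : Matrix (Fin n) (Fin n) ℝ) :
    lift C X = (1 + alpha C X)⁻¹ • (momentMatrix X + alpha C X • 1) := by
  have := alpha_nonneg hC X
  have h : 1 - alpha C X / (1 + alpha C X) = (1 + alpha C X)⁻¹ := by
    field_simp
    ring
  rw [lift, h, smul_add, smul_smul]
  congr 2
  rw [div_eq_inv_mul]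

lemma lift_apply {C : ℝ} (hC : 0 ≤ C) (X : Matrix (Fin n) (Fin n) ℝ) (S T : Idx n) :
    lift C X S T = (momentMatrix X S T + if S = T then alpha C X else 0) / (1 + alpha C X) := by
  rw [lift_eq hC, div_eq_inv_mul]
  simp [Matrix.one_apply]

lemma lift_mem_SoS4 (hX : X ∈ SoS2 n) : lift 100 X ∈ SoS4 n := by
  have hC : (0 : ℝ) ≤ 100 := by norm_num
  have hα := alpha_nonneg hC X
  refine ⟨fun S T S' T' h => ?_, ?_, ?_⟩
  · have h1 : momentMatrix X S T = momentMatrix X S' T' := by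
      simp only [momentMatrix, Matrix.of_apply, h]
    -- The identity matrix also depends only on `S ∆ T`, being supported where this is empty.
    have h2 : S = T ↔ S' = T' := by
      rw [Subtype.ext_iff, Subtype.ext_iff, ← symmDiff_eq_bot, h, symmDiff_eq_bot]
    rw [lift_apply hC, lift_apply hC, h1]
    simp only [h2]
  · rw [lift_apply hC, momentMatrix_self hX, if_pos rfl, div_self (by positivity)]
  · rw [lift_eq hC]
    exact (momentMatrix_add_posSemidef hX).smul (inv_nonneg.2 (by positivity))

end psd

end SoSLift

theorem theorem1p2 :
    ∃ C : ℝ, 0 < C ∧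
      -- the universal polynomials that give the entries; they depend on nothing but `|S ∆ T|`
      ∃ Q : (k : ℕ) → MvPolynomial (Fin k × Fin k) ℚ,
        ∀ (n : ℕ) (X : Matrix (Fin n) (Fin n) ℝ), X ∈ SoSLift.SoS2 n →
          -- the limits in the definition of the lift exist, for every factor of `X`
          (∀ M : Matrix (Fin n) (Fin n) ℝ, M * M.transpose = X →
            ∀ S T : SoSLift.Idx n,
              Filter.Tendsto (SoSLift.seedMoment M (symmDiff S.1 T.1)) Filter.atTop
                (nhds (SoSLift.momentMatrix X S T))) ∧
          SoSLift.lift C X ∈ SoSLift.SoS4 n ∧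
          (∀ i j : Fin n, i ≠ j →
            SoSLift.lift C X (SoSLift.single i) (SoSLift.single j) =
              (X i j + 2 / 3 * X i j ^ 3) /
                (1 + C * SoSLift.alphaMag X * (1 + SoSLift.alphaRow X ^ 4) *
                  (1 + SoSLift.alphaSpec X ^ 2))) ∧
          (∀ (S T : SoSLift.Idx n) (k : ℕ) (e : Fin k ↪ Fin n),
            Finset.univ.map e = symmDiff S.1 T.1 →
              SoSLift.lift C X S T =
                (MvPolynomial.aeval (fun p : Fin k × Fin k => X (e p.1) (e p.2)) (Q k) +
                    (if S = T then SoSLift.alpha C X else 0)) /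
                  (1 + SoSLift.alpha C X)) := by
  have hC : (0 : ℝ) ≤ 100 := by norm_num
  refine ⟨100, by norm_num, SoSLift.momentPoly, fun n X hX =>
    ⟨fun M hM S T => SoSLift.tendsto_momentMatrix hX hM S T, SoSLift.lift_mem_SoS4 hX,
      fun i j hij => ?_, fun S T k e he => ?_⟩⟩
  · have hne : SoSLift.single i ≠ SoSLift.single j := fun h =>
      hij (Finset.singleton_injective (congrArg Subtype.val h))
    rw [SoSLift.lift_apply hC, if_neg hne, add_zero, SoSLift.momentMatrix_pair hX hij (by
      simp only [SoSLift.single]; grind [Finset.mem_symmDiff])]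
    rfl
  · rw [SoSLift.lift_apply hC, SoSLift.momentMatrix_eq hX he]
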